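/- Let $n\ge 0$ be an integer and let $\gamma$ be the standard Gaussian measure on $\mathbb{R}^n$; write $|C|_\gamma=\gamma(C)$. For $\rho\in[-1,1]$, a pair $(X,X_\rho)$ of $\rho$-correlated standard Gaussians in $\mathbb{R}^n$ is a pair of random vectors such that $(X,X_\rho)$ is jointly Gaussian in $\mathbb{R}^{2n}$, $X$ and $X_\rho$ each have law $N(0,\mathrm{Id}_n)$, and $\mathrm{cov}(X,X_\rho)=\rho\,\mathrm{Id}_n$. Let $\Phi(t)=\frac1{\sqrt{2\pi}}\int_{-\infty}^t e^{-\ell^2/2}\,d\ell$, and for $s\in[-1,1]$ and $u,v\in[0,1]$ let $$M(u,v;s)=\mathbb{P}\big(Z<\Phi^{-1}(u),\;Z_s<\Phi^{-1}(v)\big),$$ where $(Z,Z_s)$ are $s$-correlated standard Gaussians in $\mathbb{R}$, $\Phi^{-1}(0)=-\infty$ and $\Phi^{-1}(1)=+\infty$. **Theorem (Noisy Borell's theorem).** Let $r_1,r_2\in[-1,1]$ and $s\in[-1,1]$, and set $$\rho=s\,\frac{\sqrt{(1-r_1^2)(1-r_2^2)}}{1-r_1r_2}$$ (if $r_1r_2=1$,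 where this quotient is undefined, let $\rho\in[-1,1]$ be arbitrary). Let $X,X_\rho$ be $\rho$-correlated standard Gaussians in $\mathbb{R}^n$. For $r\in[-1,1]$, $x\in\mathbb{R}^n$ and $C\subset\mathbb{R}^n$, the symbol $\frac{C-rx}{\sqrt{1-r^2}}$ stands for the set $\{y\in\mathbb{R}^n: rx+\sqrt{1-r^2}\,y\in C\}$, which is the translated and dilated set in the usual sense when $|r|<1$. Then for all Borel sets $A,B\subset\mathbb{R}^n$ the random variable $$W_{A,B}=M\left(\left|\frac{A-r_1X}{\sqrt{1-r_1^2}}\right|_\gamma,\left|\frac{B-r_2X_\rho}{\sqrt{1-r_2^2}}\right|_\gamma;s\right)$$ is integrable, and $$\mathbb{P}(X\in A,\;X_\rho\in B)\le\mathbb{E}\,W_{A,B}\quad\text{if } s\in(0,1),\qquad \mathbb{P}(X\in A,\;X_\rho\in B)\ge\mathbb{E}\,W_{A,B}\quad\text{if } s\in(-1,0).$$ Moreover, $\mathbb{P}(X\in A,\;X_\rho\in B)=\mathbb{E}\,W_{A,B}$ (for every $s\in[-1,1]$) whenever $A$ and $B$ are parallel half-spaces, i.e. open or closed half-spaces with a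 common outer normal. -/

import Mathlib

open MeasureTheory ProbabilityTheory Set
open scoped Pointwise

namespace NoisyBorell

/-- `X` and `Y` are `ρ`-correlated standard Gaussian vectors in `ℝⁿ`: the pair `(X, Y)` is jointly
Gaussian, each of `X` and `Y` has law `N(0, Id)`, and `cov(X, Y) = ρ Id`. -/
structure IsCorrelatedStdGaussian {Ω : Type*} [MeasurableSpace Ω] {n : ℕ} (ρ : ℝ)
    (X Y : Ω → EuclideanSpace ℝ (Fin n)) (P : Measure Ω) : Prop where
  hasGaussianLaw : HasGaussianLaw (fun ω => (X ω, Y ω)) P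
  hasLaw_left : HasLaw X (stdGaussian (EuclideanSpace ℝ (Fin n))) P
  hasLaw_right : HasLaw Y (stdGaussian (EuclideanSpace ℝ (Fin n))) P
  covariance_eq : ∀ i j : Fin n,
    covariance (fun ω => X ω i) (fun ω => Y ω j) P = if i = j then ρ else 0

/-- The standard Gaussian measure `|C|_γ` of a set `C ⊆ ℝⁿ`, as a real number. -/
noncomputable def gaussVol {n : ℕ} (C : Set (EuclideanSpace ℝ (Fin n))) : ℝ :=
  (stdGaussian (EuclideanSpace ℝ (Fin n))).real C

/-- The standard Gaussian distribution function `Φ` on the real line. -/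
noncomputable def Phi (t : ℝ) : ℝ := (gaussianReal 0 1).real (Iic t)

/-- The half-line `H(u) = (-∞, Φ⁻¹(u))` of Gaussian measure `u`, for `u ∈ [0, 1]`, with
`Φ⁻¹(0) = -∞` and `Φ⁻¹(1) = +∞`; thus `H(0) = ∅` and `H(1) = ℝ`. -/
def halfLine (u : ℝ) : Set ℝ := {t | Phi t < u}

/-- The law on `ℝ²` of a pair of jointly Gaussian standard normal variables with correlation
`s ∈ [-1, 1]`, realised as `(Z, s Z + √(1 - s²) Z')` with `Z, Z'` independent standard normal. -/
noncomputable def corrGaussian (s : ℝ) : Measure (ℝ × ℝ) :=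
  ((gaussianReal 0 1).prod (gaussianReal 0 1)).map
    (fun z => (z.1, s * z.1 + √(1 - s ^ 2) * z.2))

/-- `M(u, v; s) = ℙ(X ∈ H(u), X_s ∈ H(v))` for `s`-correlated standard Gaussians `X`, `X_s`. -/
noncomputable def M (u v s : ℝ) : ℝ :=
  (corrGaussian s).real (halfLine u ×ˢ halfLine v)

/-- The set `(A - r x) / √(1 - r²)`, that is, the set of all `y` with `r x + √(1 - r²) y ∈ A`.
In this form it makes sense for `r = ±1` too, where it is the whole space or empty according to
whether or not `r x ∈ A`. Its Gaussian measure is the value `T_r 1_A (x)` of the noise operator. -/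
noncomputable def noiseSection {n : ℕ} (r : ℝ) (A : Set (EuclideanSpace ℝ (Fin n)))
    (x : EuclideanSpace ℝ (Fin n)) : Set (EuclideanSpace ℝ (Fin n)) :=
  {y | r • x + √(1 - r ^ 2) • y ∈ A}

/-- For `|r| < 1` the section is literally the set `A` translated by `-r x` and divided by
`√(1 - r²)`. -/
theorem noiseSection_eq_smul {n : ℕ} {r : ℝ} (hr : r ∈ Ioo (-1 : ℝ) 1)
    (A : Set (EuclideanSpace ℝ (Fin n))) (x : EuclideanSpace ℝ (Fin n)) :
    noiseSection r A x = (√(1 - r ^ 2))⁻¹ • ((fun a => a - r • x) '' A) := by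
  have hpos : 0 < √(1 - r ^ 2) := Real.sqrt_pos.mpr (by nlinarith [hr.1, hr.2])
  ext y
  rw [mem_inv_smul_set_iff₀ hpos.ne']
  constructor
  · intro h
    exact ⟨_, h, by simp⟩
  · rintro ⟨a, ha, h⟩
    have h2 : r • x + √(1 - r ^ 2) • y = a := by
      rw [← h]; simp
    show r • x + √(1 - r ^ 2) • y ∈ A
    rwa [h2]

/-- The random variable `M(|(A - r₁ X)/√(1 - r₁²)|_γ, |(B - r₂ Y)/√(1 - r₂²)|_γ; s)`. -/
noncomputable def noisyM {Ω : Type*} {n : ℕ} (r₁ r₂ s : ℝ)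
    (A B : Set (EuclideanSpace ℝ (Fin n))) (X Y : Ω → EuclideanSpace ℝ (Fin n)) (ω : Ω) : ℝ :=
  M (gaussVol (noiseSection r₁ A (X ω))) (gaussVol (noiseSection r₂ B (Y ω))) s

/-- `A` is a half-space, open or closed, with outer normal `θ`. -/
def IsHalfspace {n : ℕ} (θ : EuclideanSpace ℝ (Fin n)) (A : Set (EuclideanSpace ℝ (Fin n))) :
    Prop :=
  ∃ a : ℝ, A = {x | inner ℝ θ x < a} ∨ A = {x | inner ℝ θ x ≤ a}

/-- `A` and `B` are parallel half-spaces, that is, half-spaces with a common outer normal. -/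
def AreParallelHalfspaces {n : ℕ} (A B : Set (EuclideanSpace ℝ (Fin n))) : Prop :=
  ∃ θ : EuclideanSpace ℝ (Fin n), θ ≠ 0 ∧ IsHalfspace θ A ∧ IsHalfspace θ B

end NoisyBorell

/-! The noise leaves the law of the pair invariant. If `(Z, Z_s)` is `s`-correlated and independent
of `(X, Y)`, then `(r₁X + √(1-r₁²)Z, r₂Y + √(1-r₂²)Z_s)` has correlation `r₁r₂ρ +
s√(1-r₁²)√(1-r₂²)`, and the prescribed `ρ` is a fixed point of this map (`correlation_eq`,
`map_mix_eq`). Conditioning on `(X, Y)` therefore writes the joint probability as the mean of the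
probability that `(Z, Z_s)` falls in a product of two noise sections
(`measureReal_prod_eq_integral_noiseSection`). Borell's inequality, applied for each value of `(X,
Y)`, gives the theorem. Sections of parallel half-spaces are again parallel half-spaces, or trivial,
so there equality holds fibre by fibre.

Borell's inequality for `s ∈ (0, 1)` comes from its functional form `E M(f(Z), g(Z_s)) ≤ M(E f, E
g)` (`integral_le_of_hasConcaveExpansion`). Interpolate by `H(t)`, in which `f` and `g` are averaged
over variance `1 - t` and then evaluated at `√t (Z, Z_s)`. Over a time step `h`, expand `M` about
the averaged values: the linear term has mean zero, and the mean of the quadratic term is controlled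
by the matrix with entries `M_uu`, `s M_uv`, `M_vv`, a negative multiple of a square
(`dM_form_nonpos`). Only an error of order `h^(3/2)` is left (`exists_step_bound`), and `N` steps of
length `1/N` make it disappear. Indicators are reached through smooth functions with values in `[δ,
1 - δ]`, and `s < 0` follows by reflecting and complementing one set. -/

namespace NoisyBorell

/-! ### Correlated Gaussian pairs and their characteristic functionals. -/

section GaussPair

variable {E : Type*} [NormedAddCommGroup E] [InnerProductSpace ℝ E]

/-- The continuous linear functional `(x, y) ↦ ⟪a, x⟫ + ⟪b, y⟫`. -/
noncomputable def pairDual (a b : E) : StrongDual ℝ (E × E) :=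
  (innerSL ℝ a).coprod (innerSL ℝ b)

@[simp] theorem pairDual_apply (a b : E) (p : E × E) :
    pairDual a b p = inner ℝ a p.1 + inner ℝ b p.2 := by
  simp [pairDual]

variable [FiniteDimensional ℝ E]

theorem exists_eq_pairDual (L : StrongDual ℝ (E × E)) : ∃ a b : E, L = pairDual a b := by
  refine ⟨(InnerProductSpace.toDual ℝ E).symm (L.comp (.inl ℝ E E)),
    (InnerProductSpace.toDual ℝ E).symm (L.comp (.inr ℝ E E)), ?_⟩
  ext p <;> simp [pairDual]

variable [MeasurableSpace E] [BorelSpace E]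

/-- The law on `E × E` of a pair of `s`-correlated standard Gaussian vectors. -/
noncomputable def gaussPair (E : Type*) [NormedAddCommGroup E] [InnerProductSpace ℝ E]
    [FiniteDimensional ℝ E] [MeasurableSpace E] [BorelSpace E] (s : ℝ) : Measure (E × E) :=
  ((stdGaussian E).prod (stdGaussian E)).map (fun z => (z.1, s • z.1 + √(1 - s ^ 2) • z.2))

/-- The continuous linear map whose image of an independent pair is an `s`-correlated pair. -/
noncomputable def pairMap (E : Type*) [NormedAddCommGroup E] [InnerProductSpace ℝ E] (s : ℝ) :
    E × E →L[ℝ] E × E :=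
  (ContinuousLinearMap.fst ℝ E E).prod
    (s • ContinuousLinearMap.fst ℝ E E + √(1 - s ^ 2) • ContinuousLinearMap.snd ℝ E E)

theorem gaussPair_eq_map (s : ℝ) :
    gaussPair E s = ((stdGaussian E).prod (stdGaussian E)).map (pairMap E s) := rfl

instance isGaussian_gaussPair (s : ℝ) : IsGaussian (gaussPair E s) := by
  rw [gaussPair_eq_map]
  infer_instance

theorem ext_of_charFunDual_pairDual {μ ν : Measure (E × E)} [IsFiniteMeasure μ]
    [IsFiniteMeasure ν] (h : ∀ a b, charFunDual μ (pairDual a b) = charFunDual ν (pairDual a b)) :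
    μ = ν := by
  apply Measure.ext_of_charFunDual
  ext L
  obtain ⟨a, b, rfl⟩ := exists_eq_pairDual L
  exact h a b

theorem charFunDual_stdGaussian_inner (a : E) :
    charFunDual (stdGaussian E) (innerSL ℝ a) = Complex.exp ((-‖a‖ ^ 2 / 2 : ℝ)) := by
  rw [charFunDual_stdGaussian]
  simp

/-- Swap, reflection, projection to a line and mixing of pairs are all checked on this quadratic
exponent. -/
theorem charFunDual_gaussPair {s : ℝ} (hs : s ∈ Icc (-1 : ℝ) 1) (a b : E) :
    charFunDual (gaussPair E s) (pairDual a b) =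
      Complex.exp ((-(‖a‖ ^ 2 + 2 * s * inner ℝ a b + ‖b‖ ^ 2) / 2 : ℝ)) := by
  rw [gaussPair_eq_map, charFunDual_map, charFunDual_prod]
  have h1 : ((pairDual a b).comp (pairMap E s)).comp (.inl ℝ E E) = innerSL ℝ (a + s • b) := by
    ext x
    simp [pairMap, inner_smul_right]
  have h2 : ((pairDual a b).comp (pairMap E s)).comp (.inr ℝ E E) =
      innerSL ℝ (√(1 - s ^ 2) • b) := by
    ext x
    simp [pairMap, inner_smul_right]
  rw [h1, h2, charFunDual_stdGaussian_inner, charFunDual_stdGaussian_inner, ← Complex.exp_add,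
    ← Complex.ofReal_add]
  congr 2
  have h3 : √(1 - s ^ 2) ^ 2 = 1 - s ^ 2 := Real.sq_sqrt (by nlinarith [hs.1, hs.2])
  rw [norm_add_sq_real, norm_smul, norm_smul, inner_smul_right, mul_pow, mul_pow, Real.norm_eq_abs,
    Real.norm_eq_abs, sq_abs, sq_abs, h3]
  ring

theorem gaussPair_map_swap {s : ℝ} (hs : s ∈ Icc (-1 : ℝ) 1) :
    (gaussPair E s).map Prod.swap = gaussPair E s := by
  apply ext_of_charFunDual_pairDual
  intro a b
  have : (Prod.swap : E × E → E × E) =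
    ((ContinuousLinearMap.snd ℝ E E).prod (ContinuousLinearMap.fst ℝ E E)) := rfl
  rw [this, charFunDual_map]
  have h : (pairDual a b).comp ((ContinuousLinearMap.snd ℝ E E).prod
      (ContinuousLinearMap.fst ℝ E E)) = pairDual b a := by
    ext x <;> simp
  rw [h, charFunDual_gaussPair hs, charFunDual_gaussPair hs, real_inner_comm]
  congr 3
  ring

theorem gaussPair_map_neg_snd {s : ℝ} (hs : s ∈ Icc (-1 : ℝ) 1) :
    (gaussPair E s).map (fun p => (p.1, -p.2)) = gaussPair E (-s) := by
  apply ext_of_charFunDual_pairDual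
  intro a b
  have : (fun p : E × E => (p.1, -p.2)) =
    ((ContinuousLinearMap.fst ℝ E E).prod (-ContinuousLinearMap.snd ℝ E E)) := rfl
  rw [this, charFunDual_map]
  have h : (pairDual a b).comp ((ContinuousLinearMap.fst ℝ E E).prod
      (-ContinuousLinearMap.snd ℝ E E)) = pairDual a (-b) := by
    ext x <;> simp
  rw [h, charFunDual_gaussPair hs, charFunDual_gaussPair (by constructor <;> linarith [hs.1, hs.2])]
  simp

theorem gaussPair_map_fst (s : ℝ) : (gaussPair E s).map Prod.fst = stdGaussian E := by
  rw [gaussPair, Measure.map_map (by fun_prop) (by fun_prop)]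
  exact Measure.map_fst_prod.trans (by simp)

theorem gaussPair_map_snd {s : ℝ} (hs : s ∈ Icc (-1 : ℝ) 1) :
    (gaussPair E s).map Prod.snd = stdGaussian E := by
  rw [← gaussPair_map_fst s]
  conv_rhs => rw [← gaussPair_map_swap hs]
  rw [Measure.map_map (by fun_prop) (by fun_prop)]
  rfl

theorem integral_id_gaussPair {s : ℝ} (hs : s ∈ Icc (-1 : ℝ) 1) :
    (gaussPair E s)[id] = 0 := by
  have hi : Integrable id (gaussPair E s) := IsGaussian.integrable_id
  ext1
  · have h1 := ContinuousLinearMap.integral_comp_comm (ContinuousLinearMap.fst ℝ E E) hi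
    have h2 := integral_map (μ := gaussPair E s) (φ := Prod.fst) (f := fun x : E => x)
      (by fun_prop) (by fun_prop)
    rw [gaussPair_map_fst, integral_id_stdGaussian] at h2
    exact h1.symm.trans h2.symm
  · have h1 := ContinuousLinearMap.integral_comp_comm (ContinuousLinearMap.snd ℝ E E) hi
    have h2 := integral_map (μ := gaussPair E s) (φ := Prod.snd) (f := fun x : E => x)
      (by fun_prop) (by fun_prop)
    rw [gaussPair_map_snd hs, integral_id_stdGaussian] at h2
    exact h1.symm.trans h2.symm

theorem memLp_two_inner_stdGaussian (a : E) :
    MemLp (fun x => inner ℝ a x) 2 (stdGaussian E) :=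
  IsGaussian.memLp_dual (stdGaussian E) (innerSL ℝ a) 2 (by simp)

theorem integral_inner_stdGaussian (a : E) : ∫ x, inner ℝ a x ∂(stdGaussian E) = 0 :=
  integral_strongDual_stdGaussian (innerSL ℝ a)

theorem integral_inner_mul_inner_stdGaussian (a b : E) :
    ∫ x, inner ℝ a x * inner ℝ b x ∂(stdGaussian E) = inner ℝ a b := by
  have h := covarianceBilin_apply (μ := stdGaussian E) IsGaussian.memLp_two_id a b
  rw [covarianceBilin_stdGaussian] at h
  rw [innerSL_apply_apply] at h
  simpa using h.symm

/-- The correlations of two linear functionals of a correlated Gaussian pair. -/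
theorem integral_inner_mul_inner_gaussPair (s : ℝ) (a b : E) :
    ∫ p, inner ℝ a p.1 * inner ℝ b p.2 ∂(gaussPair E s) = s * inner ℝ a b := by
  rw [gaussPair, integral_map (by fun_prop) (by fun_prop)]
  have hi : Integrable (fun x => inner ℝ a x * inner ℝ b x) (stdGaussian E) :=
    (memLp_two_inner_stdGaussian a).integrable_mul (memLp_two_inner_stdGaussian b)
  have h1 : Integrable (fun z : E × E => s * (inner ℝ a z.1 * inner ℝ b z.1))
      ((stdGaussian E).prod (stdGaussian E)) := (hi.comp_fst _).const_mul s
  have h2 : Integrable (fun z : E × E => √(1 - s ^ 2) * (inner ℝ a z.1 * inner ℝ b z.2))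
      ((stdGaussian E).prod (stdGaussian E)) :=
    (((memLp_two_inner_stdGaussian a).integrable (by norm_num)).mul_prod
      ((memLp_two_inner_stdGaussian b).integrable (by norm_num))).const_mul _
  have h3 : ∫ z : E × E, inner ℝ a z.1 * inner ℝ b z.1 ∂((stdGaussian E).prod (stdGaussian E)) =
      inner ℝ a b := by
    rw [integral_fun_fst (μ := stdGaussian E) (ν := stdGaussian E)
      (f := fun x => inner ℝ a x * inner ℝ b x), integral_inner_mul_inner_stdGaussian]
    simp
  calc _ = ∫ z : E × E, s * (inner ℝ a z.1 * inner ℝ b z.1) +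
        √(1 - s ^ 2) * (inner ℝ a z.1 * inner ℝ b z.2) ∂((stdGaussian E).prod (stdGaussian E)) := by
        congr with z
        simp only [inner_add_right, inner_smul_right]
        ring
    _ = _ := by
        rw [integral_add h1 h2, integral_const_mul, integral_const_mul, h3,
          integral_prod_mul (fun x => inner ℝ a x) (fun x => inner ℝ b x),
          integral_inner_stdGaussian]
        simp

theorem stdGaussian_real : stdGaussian ℝ = gaussianReal 0 1 := by
  apply Measure.ext_of_charFun
  ext t
  rw [charFun_stdGaussian, charFun_gaussianReal]
  simp [← Complex.ofReal_pow]
  congr 1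
  ring

theorem corrGaussian_eq_gaussPair (s : ℝ) : corrGaussian s = gaussPair ℝ s := by
  rw [gaussPair, stdGaussian_real]
  rfl

/-- Invariance of `s`-correlated pairs under the noise that acts on the two coordinates with
parameters `r₁` and `r₂`. -/
theorem map_mix_eq {ν : Measure (E × E)} [IsProbabilityMeasure ν] {r₁ r₂ s ρ : ℝ}
    (hr₁ : r₁ ∈ Icc (-1 : ℝ) 1) (hr₂ : r₂ ∈ Icc (-1 : ℝ) 1) (hs : s ∈ Icc (-1 : ℝ) 1)
    (hν : ∀ a b, charFunDual ν (pairDual a b) =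
      Complex.exp ((-(‖a‖ ^ 2 + 2 * ρ * inner ℝ a b + ‖b‖ ^ 2) / 2 : ℝ)))
    (hρ : ρ = r₁ * r₂ * ρ + s * (√(1 - r₁ ^ 2) * √(1 - r₂ ^ 2))) :
    (ν.prod (gaussPair E s)).map (fun q => (r₁ • q.1.1 + √(1 - r₁ ^ 2) • q.2.1,
      r₂ • q.1.2 + √(1 - r₂ ^ 2) • q.2.2)) = ν := by
  set Λ : (E × E) × (E × E) →L[ℝ] E × E :=
    (r₁ • (ContinuousLinearMap.fst ℝ E E).comp (ContinuousLinearMap.fst ℝ _ _) +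
      √(1 - r₁ ^ 2) • (ContinuousLinearMap.fst ℝ E E).comp (ContinuousLinearMap.snd ℝ _ _)).prod
    (r₂ • (ContinuousLinearMap.snd ℝ E E).comp (ContinuousLinearMap.fst ℝ _ _) +
      √(1 - r₂ ^ 2) • (ContinuousLinearMap.snd ℝ E E).comp (ContinuousLinearMap.snd ℝ _ _)) with hΛ
  have hfun : (fun q : (E × E) × (E × E) => (r₁ • q.1.1 + √(1 - r₁ ^ 2) • q.2.1,
      r₂ • q.1.2 + √(1 - r₂ ^ 2) • q.2.2)) = Λ := rfl
  rw [hfun]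
  have : IsProbabilityMeasure ((ν.prod (gaussPair E s)).map Λ) :=
    Measure.isProbabilityMeasure_map (by fun_prop)
  apply ext_of_charFunDual_pairDual
  intro a b
  rw [charFunDual_map, charFunDual_prod]
  have h1 : ((pairDual a b).comp Λ).comp (.inl ℝ _ _) = pairDual (r₁ • a) (r₂ • b) := by
    ext x <;> simp [hΛ, inner_smul_left, inner_smul_right]
  have h2 : ((pairDual a b).comp Λ).comp (.inr ℝ _ _) =
      pairDual (√(1 - r₁ ^ 2) • a) (√(1 - r₂ ^ 2) • b) := by
    ext x <;> simp [hΛ, inner_smul_left, inner_smul_right]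
  rw [h1, h2, hν, hν, charFunDual_gaussPair hs, ← Complex.exp_add, ← Complex.ofReal_add]
  congr 2
  have h3 : √(1 - r₁ ^ 2) ^ 2 = 1 - r₁ ^ 2 := Real.sq_sqrt (by nlinarith [hr₁.1, hr₁.2])
  have h4 : √(1 - r₂ ^ 2) ^ 2 = 1 - r₂ ^ 2 := Real.sq_sqrt (by nlinarith [hr₂.1, hr₂.2])
  simp only [norm_smul, mul_pow, Real.norm_eq_abs, sq_abs, inner_smul_left, inner_smul_right, h3,
    h4, conj_trivial]
  -- The squared norms recombine through `r² + (1 - r²) = 1`; the coefficient of the inner product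
  -- is the fixed-point equation for `ρ`.
  linear_combination (inner ℝ a b) * hρ

/-- The sum of independent copies of a centred Gaussian vector is again Gaussian. -/
theorem integral_integral_add_of_centered {V : Type*} [NormedAddCommGroup V] [NormedSpace ℝ V]
    [MeasurableSpace V] [BorelSpace V] [SecondCountableTopology V] [CompleteSpace V]
    {μ : Measure V} [IsGaussian μ] (hμ : μ[id] = 0) {G : V → ℝ} (hG : Measurable G) {C : ℝ}
    (hGC : ∀ x, |G x| ≤ C) {a b : ℝ} (ha : 0 ≤ a) (hb : 0 ≤ b) (v : V) :
    ∫ p, ∫ q, G (v + √a • p + √b • q) ∂μ ∂μ = ∫ p, G (v + √(a + b) • p) ∂μ := by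
  have hint : Integrable (fun z : V × V => G (v + √a • z.1 + √b • z.2)) (μ.prod μ) :=
    Integrable.of_bound (C := C) (hG.comp (by fun_prop)).aestronglyMeasurable
      (Filter.Eventually.of_forall fun z => hGC _)
  rw [← integral_prod _ hint]
  -- The argument of `√a + i√b` serves also when `a + b = 0`. The sum is then `√(a + b)` times the
  -- first coordinate of a rotated independent pair, and a centred Gaussian product is rotation
  -- invariant.
  obtain ⟨θ, hc, hsn⟩ : ∃ θ : ℝ, √a = √(a + b) * Real.cos θ ∧ √b = √(a + b) * Real.sin θ := by
    refine ⟨Complex.arg ⟨√a, √b⟩, ?_⟩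
    have hn : ‖(⟨√a, √b⟩ : ℂ)‖ = √(a + b) := by
      rw [Complex.norm_eq_sqrt_sq_add_sq, Real.sq_sqrt ha, Real.sq_sqrt hb]
    rw [← hn, Complex.norm_mul_cos_arg, Complex.norm_mul_sin_arg]
    exact ⟨rfl, rfl⟩
  have hrot := IsGaussian.map_rotation_eq_self hμ θ
  have h1 : (fun z : V × V => G (v + √a • z.1 + √b • z.2)) =
      fun z => G (v + √(a + b) • (ContinuousLinearMap.rotation θ z).1) := by
    ext z
    rw [ContinuousLinearMap.rotation_apply, hc, hsn]
    simp only [smul_add, smul_smul, add_assoc]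
  rw [h1]
  have h2 := integral_map (μ := μ.prod μ) (φ := ContinuousLinearMap.rotation θ)
    (f := fun z : V × V => G (v + √(a + b) • z.1)) (by fun_prop)
    (hG.comp (by fun_prop)).aestronglyMeasurable
  rw [← h2, hrot, integral_fun_fst (μ := μ) (ν := μ) (f := fun p => G (v + √(a + b) • p))]
  simp

end GaussPair

/-! ### The characteristic functional of the given pair. -/

section Correlated

variable {Ω : Type*} [MeasurableSpace Ω] {P : Measure Ω} {n : ℕ} {ρ : ℝ}
  {X Y : Ω → EuclideanSpace ℝ (Fin n)}

/-- The rest of the proof knows the joint law only through this formula. Identifying it with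
`gaussPair` would require `ρ ∈ [-1, 1]`, which does not follow from the structure when `n = 0`. -/
theorem IsCorrelatedStdGaussian.charFunDual_map [IsProbabilityMeasure P]
    (h : IsCorrelatedStdGaussian ρ X Y P) (a b : EuclideanSpace ℝ (Fin n)) :
    charFunDual (P.map (fun ω => (X ω, Y ω))) (pairDual a b) =
      Complex.exp ((-(‖a‖ ^ 2 + 2 * ρ * inner ℝ a b + ‖b‖ ^ 2) / 2 : ℝ)) := by
  have hX := h.hasLaw_left
  have hY := h.hasLaw_right
  have hmeanX : ∫ ω, inner ℝ a (X ω) ∂P = 0 := by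
    rw [← integral_inner_stdGaussian a, ← hX.map_eq,
      integral_map hX.aemeasurable (by fun_prop)]
  have hmeanY : ∫ ω, inner ℝ b (Y ω) ∂P = 0 := by
    rw [← integral_inner_stdGaussian b, ← hY.map_eq,
      integral_map hY.aemeasurable (by fun_prop)]
  have hLX : ∀ a, MemLp (fun ω => inner ℝ a (X ω)) 2 P := fun a => by
    have := memLp_two_inner_stdGaussian a
    rw [← hX.map_eq] at this
    exact this.comp_of_map hX.aemeasurable
  have hLY : ∀ a, MemLp (fun ω => inner ℝ a (Y ω)) 2 P := fun a => by
    have := memLp_two_inner_stdGaussian a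
    rw [← hY.map_eq] at this
    exact this.comp_of_map hY.aemeasurable
  have hvarX : Var[fun ω => inner ℝ a (X ω); P] = ‖a‖ ^ 2 := by
    have := variance_dual_stdGaussian (innerSL ℝ a)
    rw [← hX.map_eq, variance_map (by fun_prop) hX.aemeasurable] at this
    simpa [Function.comp_def] using this
  have hvarY : Var[fun ω => inner ℝ b (Y ω); P] = ‖b‖ ^ 2 := by
    have := variance_dual_stdGaussian (innerSL ℝ b)
    rw [← hY.map_eq, variance_map (by fun_prop) hY.aemeasurable] at this
    simpa [Function.comp_def] using this
  have hcov : cov[fun ω => inner ℝ a (X ω), fun ω => inner ℝ b (Y ω); P] = ρ * inner ℝ a b := by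
    have hb : ∀ (i : Fin n), MemLp (fun ω => X ω i) 2 P := fun i => by
      simpa [EuclideanSpace.inner_single_left] using hLX (EuclideanSpace.single i 1)
    have hb' : ∀ (i : Fin n), MemLp (fun ω => Y ω i) 2 P := fun i => by
      simpa [EuclideanSpace.inner_single_left] using hLY (EuclideanSpace.single i 1)
    simp only [PiLp.inner_apply, RCLike.inner_apply, conj_trivial]
    rw [covariance_fun_sum_fun_sum (fun i => (hb i).mul_const _) (fun i => (hb' i).mul_const _)]
    simp only [covariance_mul_const_left, covariance_mul_const_right, h.covariance_eq]
    simp [Finset.mul_sum]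
    exact Finset.sum_congr rfl fun i _ => by ring
  have hL : (fun ω => pairDual a b (X ω, Y ω)) =
      fun ω => inner ℝ a (X ω) + inner ℝ b (Y ω) := by
    ext ω
    simp
  rw [h.hasGaussianLaw.charFunDual_map_eq_fun, hL]
  have hm : ∫ ω, (inner ℝ a (X ω) + inner ℝ b (Y ω)) ∂P = 0 := by
    rw [integral_add ((hLX a).integrable (by norm_num)) ((hLY b).integrable (by norm_num)),
      hmeanX, hmeanY, add_zero]
  rw [variance_fun_add (hLX a) (hLY b), hvarX, hvarY, hcov, hm]
  congr 1
  push_cast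
  ring

end Correlated

/-! ### The Gaussian distribution function, its inverse, and half-lines. -/

section OneDimensional

open Filter Topology

theorem hasDerivAt_integral_Iic {f : ℝ → ℝ} (hf : Integrable f) (hc : Continuous f) (a : ℝ) :
    HasDerivAt (fun t => ∫ x in Iic t, f x) (f a) a := by
  have h1 : (fun t => ∫ x in Iic t, f x) = fun t => (∫ x in Iic a, f x) + ∫ x in a..t, f x := by
    ext t
    rw [← intervalIntegral.integral_Iic_sub_Iic hf.integrableOn hf.integrableOn]
    ring
  rw [h1]
  exact (intervalIntegral.integral_hasDerivAt_right (hc.intervalIntegrable a a)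
    hc.aestronglyMeasurable.stronglyMeasurableAtFilter hc.continuousAt).const_add _

/-- The standard Gaussian density on the real line. -/
noncomputable def gaussDensity (x : ℝ) : ℝ := gaussianPDFReal 0 1 x

theorem gaussDensity_eq (x : ℝ) : gaussDensity x = (√(2 * Real.pi))⁻¹ * Real.exp (-x ^ 2 / 2) := by
  simp [gaussDensity, gaussianPDFReal_def]

theorem gaussDensity_pos (x : ℝ) : 0 < gaussDensity x := gaussianPDFReal_pos _ _ _ one_ne_zero

theorem contDiff_gaussDensity : ContDiff ℝ 1 gaussDensity := by
  rw [funext gaussDensity_eq]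
  fun_prop

theorem continuous_gaussDensity : Continuous gaussDensity := contDiff_gaussDensity.continuous

theorem integrable_gaussDensity : Integrable gaussDensity := integrable_gaussianPDFReal 0 1

instance nullSingletonClass_gaussianReal_zero_one : NullSingletonClass (gaussianReal 0 1) :=
  nullSingletonClass_gaussianReal one_ne_zero

theorem Phi_eq_integral (t : ℝ) : Phi t = ∫ x in Iic t, gaussDensity x := by
  rw [Phi, measureReal_def, gaussianReal_apply_eq_integral _ one_ne_zero, ENNReal.toReal_ofReal]
  · rfl
  · exact integral_nonneg fun x => (gaussDensity_pos x).le

theorem Phi_eq_cdf (t : ℝ) : Phi t = cdf (gaussianReal 0 1) t := by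
  rw [cdf_eq_real, Phi]

theorem hasDerivAt_Phi (t : ℝ) : HasDerivAt Phi (gaussDensity t) t := by
  rw [funext Phi_eq_integral]
  exact hasDerivAt_integral_Iic integrable_gaussDensity continuous_gaussDensity t

theorem strictMono_Phi : StrictMono Phi :=
  strictMono_of_hasDerivAt_pos hasDerivAt_Phi gaussDensity_pos

theorem continuous_Phi : Continuous Phi :=
  continuous_iff_continuousAt.2 fun t => (hasDerivAt_Phi t).continuousAt

theorem Phi_nonneg (t : ℝ) : 0 ≤ Phi t := measureReal_nonneg

theorem Phi_le_one (t : ℝ) : Phi t ≤ 1 := measureReal_le_one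

theorem Phi_mem_Ioo (t : ℝ) : Phi t ∈ Ioo (0 : ℝ) 1 :=
  ⟨(Phi_nonneg (t - 1)).trans_lt (strictMono_Phi (by linarith)),
    (strictMono_Phi (by linarith : t < t + 1)).trans_le (Phi_le_one _)⟩

theorem exists_Phi_eq {u : ℝ} (hu : u ∈ Ioo (0 : ℝ) 1) : ∃ t, Phi t = u := by
  have hb : Tendsto Phi atBot (𝓝 0) := by
    rw [funext Phi_eq_cdf]; exact tendsto_cdf_atBot _
  have ht : Tendsto Phi atTop (𝓝 1) := by
    rw [funext Phi_eq_cdf]; exact tendsto_cdf_atTop _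
  obtain ⟨a, ha⟩ := (hb.eventually (gt_mem_nhds hu.1)).exists
  obtain ⟨b, hb⟩ := (ht.eventually (lt_mem_nhds hu.2)).exists
  exact mem_range_of_exists_le_of_exists_ge continuous_Phi ⟨a, ha.le⟩ ⟨b, hb.le⟩

/-- The Gaussian quantile function `Φ⁻¹`. -/
noncomputable def quantile (u : ℝ) : ℝ := Function.invFun Phi u

theorem Phi_quantile {u : ℝ} (hu : u ∈ Ioo (0 : ℝ) 1) : Phi (quantile u) = u :=
  Function.invFun_eq (exists_Phi_eq hu)

theorem quantile_Phi (t : ℝ) : quantile (Phi t) = t :=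
  Function.leftInverse_invFun strictMono_Phi.injective t

theorem hasDerivAt_quantile {u : ℝ} (hu : u ∈ Ioo (0 : ℝ) 1) :
    HasDerivAt quantile (gaussDensity (quantile u))⁻¹ u := by
  have hmem : Ioo (0 : ℝ) 1 ∈ 𝓝 u := isOpen_Ioo.mem_nhds hu
  have hmono : StrictMonoOn quantile (Ioo 0 1) := fun x hx y hy hxy => by
    rwa [← strictMono_Phi.lt_iff_lt, Phi_quantile hx, Phi_quantile hy]
  have himg : quantile '' Ioo 0 1 = univ :=
    eq_univ_of_forall fun t => ⟨Phi t, Phi_mem_Ioo t, quantile_Phi t⟩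
  -- A strictly monotone function whose image is the whole line cannot jump.
  have hcont : ContinuousAt quantile u :=
    hmono.continuousAt_of_image_mem_nhds hmem (by rw [himg]; exact univ_mem)
  exact HasDerivAt.of_local_left_inverse hcont (hasDerivAt_Phi _) (gaussDensity_pos _).ne'
    (eventually_of_mem hmem fun y hy => Phi_quantile hy)

theorem contDiffOn_quantile : ContDiffOn ℝ 1 quantile (Ioo 0 1) := by
  rw [show (1 : WithTop ℕ∞) = 0 + 1 from rfl, contDiffOn_succ_iff_deriv_of_isOpen isOpen_Ioo]
  refine ⟨fun u hu => (hasDerivAt_quantile hu).differentiableAt.differentiableWithinAt,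
    by simp, ?_⟩
  rw [contDiffOn_zero]
  have h : ContinuousOn (fun u => (gaussDensity (quantile u))⁻¹) (Ioo 0 1) :=
    ContinuousOn.inv₀ (continuous_gaussDensity.comp_continuousOn fun u hu =>
      (hasDerivAt_quantile hu).continuousAt.continuousWithinAt) fun u _ => (gaussDensity_pos _).ne'
  exact h.congr fun u hu => (hasDerivAt_quantile hu).deriv

theorem halfLine_eq_Iio {u : ℝ} (hu : u ∈ Ioo (0 : ℝ) 1) : halfLine u = Iio (quantile u) := by
  ext t
  rw [mem_Iio, ← strictMono_Phi.lt_iff_lt, Phi_quantile hu]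
  rfl

theorem halfLine_of_nonpos {u : ℝ} (hu : u ≤ 0) : halfLine u = ∅ :=
  eq_empty_of_forall_notMem fun t ht => (hu.trans (Phi_nonneg t)).not_gt ht

theorem halfLine_of_one_le {u : ℝ} (hu : 1 ≤ u) : halfLine u = univ :=
  eq_univ_of_forall fun t => (Phi_mem_Ioo t).2.trans_le hu

theorem measurableSet_halfLine (u : ℝ) : MeasurableSet (halfLine u) :=
  measurableSet_lt continuous_Phi.measurable measurable_const

theorem halfLine_mono {u v : ℝ} (h : u ≤ v) : halfLine u ⊆ halfLine v :=
  fun _ ht => lt_of_lt_of_le ht h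

theorem gaussianReal_Iio (t : ℝ) : (gaussianReal 0 1).real (Iio t) = Phi t :=
  measureReal_congr Iio_ae_eq_Iic

theorem gaussianReal_halfLine {u : ℝ} (hu : u ∈ Icc (0 : ℝ) 1) :
    (gaussianReal 0 1).real (halfLine u) = u := by
  rcases hu.1.eq_or_lt with rfl | h0
  · simp [halfLine_of_nonpos le_rfl]
  rcases hu.2.eq_or_lt with rfl | h1
  · simp [halfLine_of_one_le le_rfl]
  rw [halfLine_eq_Iio ⟨h0, h1⟩, gaussianReal_Iio, Phi_quantile ⟨h0, h1⟩]

/-- A lower set of the real line is, up to a null set, the half-line of the same measure. -/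
theorem ae_eq_halfLine_of_isLowerSet {L : Set ℝ} (hL : IsLowerSet L) :
    L =ᵐ[gaussianReal 0 1] halfLine ((gaussianReal 0 1).real L) := by
  set u := (gaussianReal 0 1).real L with hu
  have h1 : halfLine u ⊆ L := by
    intro t ht
    by_contra htL
    have hsub : L ⊆ Iic t := fun x hx => by
      by_contra hxt
      exact htL (hL (le_of_lt (not_le.1 hxt)) hx)
    exact (lt_of_lt_of_le ht (measureReal_mono hsub)).false
  -- The excess lies in a level set of the injective `Phi`, hence is at most one point.
  have h2 : L \ halfLine u ⊆ {t | Phi t = u} := by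
    rintro t ⟨htL, ht⟩
    exact le_antisymm (measureReal_mono fun x hx => hL hx htL) (not_lt.1 ht)
  have h3 : ({t | Phi t = u} : Set ℝ).Subsingleton := fun x hx y hy =>
    strictMono_Phi.injective (hx.trans hy.symm)
  have h4 : gaussianReal 0 1 (L \ halfLine u) = 0 :=
    measure_mono_null h2 (h3.measure_zero _)
  exact Filter.EventuallyLE.antisymm (ae_le_set.2 h4)
    (h1.eventuallyLE)

end OneDimensional

/-! ### Lipschitz bounds, derivatives and weighted concavity of `M`. -/

section BivariateM

open Filter Topology

instance isProbabilityMeasure_corrGaussian (s : ℝ) : IsProbabilityMeasure (corrGaussian s) := by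
  rw [corrGaussian_eq_gaussPair]; infer_instance

theorem corrGaussian_real_le_left {s : ℝ} (S T : Set ℝ) (hS : MeasurableSet S) :
    (corrGaussian s).real (S ×ˢ T) ≤ (gaussianReal 0 1).real S := by
  have h : (corrGaussian s).map Prod.fst = gaussianReal 0 1 := by
    rw [corrGaussian_eq_gaussPair, gaussPair_map_fst, stdGaussian_real]
  rw [← h, map_measureReal_apply measurable_fst hS]
  exact measureReal_mono fun p hp => hp.1

theorem M_nonneg (u v s : ℝ) : 0 ≤ M u v s := measureReal_nonneg

theorem M_le_one (u v s : ℝ) : M u v s ≤ 1 := measureReal_le_one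

theorem M_mono {u u' v v' : ℝ} (s : ℝ) (hu : u ≤ u') (hv : v ≤ v') : M u v s ≤ M u' v' s :=
  measureReal_mono (prod_mono (halfLine_mono hu) (halfLine_mono hv))

theorem measurable_M (s : ℝ) : Measurable fun p : ℝ × ℝ => M p.1 p.2 s := by
  have h : MeasurableSet {q : (ℝ × ℝ) × (ℝ × ℝ) | Phi q.2.1 < q.1.1 ∧ Phi q.2.2 < q.1.2} :=
    (measurableSet_lt (continuous_Phi.measurable.comp (by fun_prop)) (by fun_prop)).inter
      (measurableSet_lt (continuous_Phi.measurable.comp (by fun_prop)) (by fun_prop))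
  exact (measurable_measure_prodMk_left (ν := corrGaussian s) h).ennreal_toReal

theorem M_comm {s : ℝ} (hs : s ∈ Icc (-1 : ℝ) 1) (u v : ℝ) : M u v s = M v u s := by
  have h := gaussPair_map_swap (E := ℝ) hs
  rw [M, M, corrGaussian_eq_gaussPair]
  conv_lhs => rw [← h]
  rw [map_measureReal_apply measurable_swap
    ((measurableSet_halfLine _).prod (measurableSet_halfLine _)), preimage_swap_prod]

/-- Enlarging the first half-line adds at most a vertical strip, whose mass is read off the standard
Gaussian marginal. With symmetry this makes all approximation errors linear in `δ`. -/
theorem M_sub_left_le {u u' : ℝ} (v s : ℝ) (hu : 0 ≤ u) (huu : u ≤ u') :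
    M u' v s - M u v s ≤ u' - u := by
  rcases le_or_gt 1 u with h1 | h1
  · rw [M, M, halfLine_of_one_le h1, halfLine_of_one_le (h1.trans huu)]
    linarith
  -- The bound is later used at `γ(A) + 2δ`, which may exceed `1`; beyond `1` the half-line no
  -- longer grows.
  have hu1 : min u' 1 ∈ Icc (0 : ℝ) 1 := ⟨le_min (hu.trans huu) zero_le_one, min_le_right _ _⟩
  have hmin : halfLine u' = halfLine (min u' 1) := by
    rcases le_total u' 1 with h | h
    · rw [min_eq_left h]
    · rw [min_eq_right h, halfLine_of_one_le h, halfLine_of_one_le le_rfl]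
  have hle : u ≤ min u' 1 := le_min huu h1.le
  have hsub : halfLine u' ×ˢ halfLine v \ halfLine u ×ˢ halfLine v ⊆
      (halfLine (min u' 1) \ halfLine u) ×ˢ univ := by
    rw [← hmin]
    rintro p ⟨⟨hp1, hp2⟩, hp⟩
    exact ⟨⟨hp1, fun h => hp ⟨h, hp2⟩⟩, mem_univ _⟩
  have hd : M u' v s - M u v s = (corrGaussian s).real
      (halfLine u' ×ˢ halfLine v \ halfLine u ×ˢ halfLine v) := by
    rw [measureReal_sdiff (prod_mono (halfLine_mono huu) le_rfl)
      ((measurableSet_halfLine _).prod (measurableSet_halfLine _))]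
    rfl
  rw [hd]
  refine (measureReal_mono hsub).trans ?_
  refine (corrGaussian_real_le_left _ _
    ((measurableSet_halfLine _).diff (measurableSet_halfLine _))).trans ?_
  rw [measureReal_sdiff (halfLine_mono hle) (measurableSet_halfLine _), gaussianReal_halfLine hu1,
    gaussianReal_halfLine ⟨hu, h1.le⟩]
  linarith [min_le_left u' 1]

theorem M_sub_le {u u' v v' s : ℝ} (hs : s ∈ Icc (-1 : ℝ) 1) (hu : 0 ≤ u) (huu : u ≤ u')
    (hv : 0 ≤ v) (hvv : v ≤ v') : M u' v' s - M u v s ≤ (u' - u) + (v' - v) := by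
  have h1 := M_sub_left_le v' s hu huu
  have h2 := M_sub_left_le u s hv hvv
  rw [M_comm hs v' u, M_comm hs v u] at h2
  linarith

/-- The distribution function of a correlated Gaussian pair. -/
noncomputable def bivariateCDF (s a b : ℝ) : ℝ := (corrGaussian s).real (Iio a ×ˢ Iio b)

theorem M_eq_bivariateCDF {u v : ℝ} (hu : u ∈ Ioo (0 : ℝ) 1) (hv : v ∈ Ioo (0 : ℝ) 1) (s : ℝ) :
    M u v s = bivariateCDF s (quantile u) (quantile v) := by
  rw [M, halfLine_eq_Iio hu, halfLine_eq_Iio hv, bivariateCDF]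

theorem bivariateCDF_comm {s : ℝ} (hs : s ∈ Icc (-1 : ℝ) 1) (a b : ℝ) :
    bivariateCDF s a b = bivariateCDF s b a := by
  have h := gaussPair_map_swap (E := ℝ) hs
  rw [bivariateCDF, bivariateCDF, corrGaussian_eq_gaussPair]
  conv_lhs => rw [← h]
  rw [map_measureReal_apply measurable_swap (measurableSet_Iio.prod measurableSet_Iio),
    preimage_swap_prod]

/-- Condition on the first coordinate `x`: the second is then normal with mean `s x` and standard
deviation `√(1 - s²)`, which is positive because `|s| < 1`. -/
theorem bivariateCDF_eq_integral {s : ℝ} (hs : s ∈ Ioo (-1 : ℝ) 1) (a b : ℝ) :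
    bivariateCDF s a b =
      ∫ x in Iic a, gaussDensity x * Phi ((b - s * x) / √(1 - s ^ 2)) := by
  have hσ : 0 < √(1 - s ^ 2) := Real.sqrt_pos.2 (by nlinarith [hs.1, hs.2])
  have hmeas : Measurable (fun z : ℝ × ℝ => (z.1, s * z.1 + √(1 - s ^ 2) * z.2)) := by fun_prop
  have hS : MeasurableSet ((fun z : ℝ × ℝ => (z.1, s * z.1 + √(1 - s ^ 2) * z.2)) ⁻¹'
    (Iio a ×ˢ Iio b)) := hmeas (measurableSet_Iio.prod measurableSet_Iio)
  rw [bivariateCDF, corrGaussian,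
    map_measureReal_apply hmeas (measurableSet_Iio.prod measurableSet_Iio), measureReal_def,
    Measure.prod_apply hS, ← integral_toReal (measurable_measure_prodMk_left hS).aemeasurable
      (Eventually.of_forall fun x => measure_lt_top _ _)]
  have h1 : ∀ x, (gaussianReal 0 1 (Prod.mk x ⁻¹' ((fun z : ℝ × ℝ =>
      (z.1, s * z.1 + √(1 - s ^ 2) * z.2)) ⁻¹' (Iio a ×ˢ Iio b)))).toReal =
      (Iio a).indicator (fun x => Phi ((b - s * x) / √(1 - s ^ 2))) x := by
    intro x
    by_cases hx : x < a
    · rw [indicator_of_mem (mem_Iio.2 hx), ← gaussianReal_Iio, measureReal_def]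
      congr 2
      ext y
      simp only [mem_preimage, mem_prod, mem_Iio, hx, true_and]
      rw [lt_div_iff₀ hσ]
      constructor <;> intro h <;> linarith
    · rw [indicator_of_notMem (by simpa using hx)]
      have : (Prod.mk x ⁻¹' ((fun z : ℝ × ℝ => (z.1, s * z.1 + √(1 - s ^ 2) * z.2)) ⁻¹'
          (Iio a ×ˢ Iio b))) = ∅ := by
        ext y
        simp [hx]
      simp [this]
  simp_rw [h1]
  rw [integral_gaussianReal_eq_integral_smul one_ne_zero, integral_Iic_eq_integral_Iio,
    ← integral_indicator measurableSet_Iio]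
  congr with x
  by_cases hx : x ∈ Iio a
  · simp [indicator_of_mem hx, gaussDensity]
  · simp [indicator_of_notMem hx]

theorem hasDerivAt_bivariateCDF_left {s : ℝ} (hs : s ∈ Ioo (-1 : ℝ) 1) (a b : ℝ) :
    HasDerivAt (fun t => bivariateCDF s t b)
      (gaussDensity a * Phi ((b - s * a) / √(1 - s ^ 2))) a := by
  rw [funext fun t => bivariateCDF_eq_integral hs t b]
  have hc : Continuous fun x => Phi ((b - s * x) / √(1 - s ^ 2)) :=
    continuous_Phi.comp (by fun_prop)
  refine hasDerivAt_integral_Iic (integrable_gaussDensity.mul_bdd (c := 1) hc.aestronglyMeasurable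
    (Eventually.of_forall fun x => ?_)) (continuous_gaussDensity.mul hc) a
  rw [Real.norm_eq_abs, abs_of_nonneg (Phi_nonneg _)]
  exact Phi_le_one _

theorem hasDerivAt_bivariateCDF_right {s : ℝ} (hs : s ∈ Ioo (-1 : ℝ) 1) (a b : ℝ) :
    HasDerivAt (fun t => bivariateCDF s a t)
      (gaussDensity b * Phi ((a - s * b) / √(1 - s ^ 2))) b := by
  rw [funext fun t => bivariateCDF_comm (Ioo_subset_Icc_self hs) a t]
  exact hasDerivAt_bivariateCDF_left hs b a

theorem hasFDerivAt_bivariateCDF {s : ℝ} (hs : s ∈ Ioo (-1 : ℝ) 1) (a b : ℝ) :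
    HasFDerivAt (fun p : ℝ × ℝ => bivariateCDF s p.1 p.2)
      ((ContinuousLinearMap.toSpanSingleton ℝ
          (gaussDensity a * Phi ((b - s * a) / √(1 - s ^ 2)))).coprod
        (ContinuousLinearMap.toSpanSingleton ℝ
          (gaussDensity b * Phi ((a - s * b) / √(1 - s ^ 2))))) (a, b) := by
  have hspan : Continuous fun x : ℝ => ContinuousLinearMap.toSpanSingleton ℝ x :=
    (ContinuousLinearMap.toSpanSingletonLE ℝ ℝ ℝ).toContinuousLinearMap.continuous
  have h1 : Continuous fun p : ℝ × ℝ => ContinuousLinearMap.toSpanSingleton ℝ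
      (gaussDensity p.1 * Phi ((p.2 - s * p.1) / √(1 - s ^ 2))) :=
    hspan.comp ((continuous_gaussDensity.comp (by fun_prop)).mul
      (continuous_Phi.comp (by fun_prop)))
  have h2 : Continuous fun p : ℝ × ℝ => ContinuousLinearMap.toSpanSingleton ℝ
      (gaussDensity p.2 * Phi ((p.1 - s * p.2) / √(1 - s ^ 2))) :=
    hspan.comp ((continuous_gaussDensity.comp (by fun_prop)).mul
      (continuous_Phi.comp (by fun_prop)))
  exact (hasStrictFDerivAt_uncurry_coprod (f := bivariateCDF s)
    (f₁ := fun a b => ContinuousLinearMap.toSpanSingleton ℝ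
          (gaussDensity a * Phi ((b - s * a) / √(1 - s ^ 2))))
    (f₂ := fun a b => ContinuousLinearMap.toSpanSingleton ℝ
          (gaussDensity b * Phi ((a - s * b) / √(1 - s ^ 2)))) (u := (a, b))
    (Eventually.of_forall fun p => (hasDerivAt_bivariateCDF_left hs p.1 p.2).hasFDerivAt)
    (Eventually.of_forall fun p => (hasDerivAt_bivariateCDF_right hs p.1 p.2).hasFDerivAt)
    h1.continuousAt h2.continuousAt).hasFDerivAt

/-- The chain rule for the distribution function of a correlated Gaussian pair. -/
theorem hasDerivAt_bivariateCDF_comp {s : ℝ} (hs : s ∈ Ioo (-1 : ℝ) 1) {a b : ℝ → ℝ}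
    {a' b' t : ℝ} (ha : HasDerivAt a a' t) (hb : HasDerivAt b b' t) :
    HasDerivAt (fun t => bivariateCDF s (a t) (b t))
      (a' * (gaussDensity (a t) * Phi ((b t - s * a t) / √(1 - s ^ 2))) +
        b' * (gaussDensity (b t) * Phi ((a t - s * b t) / √(1 - s ^ 2)))) t := by
  have h := (hasFDerivAt_bivariateCDF hs (a t) (b t)).comp_hasDerivAt t (ha.prodMk hb)
  refine h.congr_deriv ?_
  simp

/-- `∂M/∂u` at `(u, v)`; the derivative `∂M/∂v` is obtained by exchanging `u` and `v`. -/
noncomputable def dM (s u v : ℝ) : ℝ :=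
  Phi ((quantile v - s * quantile u) / √(1 - s ^ 2))

/-- `∂²M/∂u²` at `(u, v)`. -/
noncomputable def dMuu (s u v : ℝ) : ℝ :=
  -(s / √(1 - s ^ 2)) * gaussDensity ((quantile v - s * quantile u) / √(1 - s ^ 2)) /
    gaussDensity (quantile u)

/-- `∂²M/∂u∂v` at `(u, v)`. -/
noncomputable def dMuv (s u v : ℝ) : ℝ :=
  (√(1 - s ^ 2))⁻¹ * gaussDensity ((quantile v - s * quantile u) / √(1 - s ^ 2)) /
    gaussDensity (quantile v)

theorem hasDerivAt_segment_quantile {u ξ t : ℝ} (h : u + t * ξ ∈ Ioo (0 : ℝ) 1) :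
    HasDerivAt (fun t => quantile (u + t * ξ)) (ξ / gaussDensity (quantile (u + t * ξ))) t := by
  have h1 : HasDerivAt (fun t => u + t * ξ) ξ t := by
    simpa using ((hasDerivAt_id t).mul_const ξ).const_add u
  have h2 := (hasDerivAt_quantile h).comp t h1
  rwa [inv_mul_eq_div] at h2

/-- The density in the derivative of the distribution function cancels against the derivative of
`quantile`, so the partial derivatives `dM` are bare values of `Phi`. -/
theorem hasDerivAt_segment_M {s : ℝ} (hs : s ∈ Ioo (-1 : ℝ) 1) {u v ξ η t : ℝ}
    (hu : u + t * ξ ∈ Ioo (0 : ℝ) 1) (hv : v + t * η ∈ Ioo (0 : ℝ) 1) :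
    HasDerivAt (fun t => M (u + t * ξ) (v + t * η) s)
      (ξ * dM s (u + t * ξ) (v + t * η) + η * dM s (v + t * η) (u + t * ξ)) t := by
  have hcont : ∀ u ξ : ℝ, Continuous fun t : ℝ => u + t * ξ := fun u ξ => by fun_prop
  have h := hasDerivAt_bivariateCDF_comp hs (hasDerivAt_segment_quantile hu)
    (hasDerivAt_segment_quantile hv)
  have hev : (fun t => M (u + t * ξ) (v + t * η) s) =ᶠ[𝓝 t]
      fun t => bivariateCDF s (quantile (u + t * ξ)) (quantile (v + t * η)) := by
    filter_upwards [(hcont u ξ).continuousAt.eventually_mem (isOpen_Ioo.mem_nhds hu),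
      (hcont v η).continuousAt.eventually_mem (isOpen_Ioo.mem_nhds hv)] with x hx hy
    exact M_eq_bivariateCDF hx hy s
  refine (h.congr_of_eventuallyEq hev).congr_deriv ?_
  have h1 := (gaussDensity_pos (quantile (u + t * ξ))).ne'
  have h2 := (gaussDensity_pos (quantile (v + t * η))).ne'
  rw [dM, dM, ← mul_assoc, div_mul_cancel₀ _ h1, ← mul_assoc, div_mul_cancel₀ _ h2]

theorem hasDerivAt_segment_dM {s : ℝ} {u v ξ η t : ℝ}
    (hu : u + t * ξ ∈ Ioo (0 : ℝ) 1) (hv : v + t * η ∈ Ioo (0 : ℝ) 1) :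
    HasDerivAt (fun t => dM s (u + t * ξ) (v + t * η))
      (ξ * dMuu s (u + t * ξ) (v + t * η) + η * dMuv s (u + t * ξ) (v + t * η)) t := by
  have h := (hasDerivAt_Phi ((quantile (v + t * η) - s * quantile (u + t * ξ)) /
    √(1 - s ^ 2))).comp t (((hasDerivAt_segment_quantile hv).sub
      ((hasDerivAt_segment_quantile hu).const_mul s)).div_const (√(1 - s ^ 2)))
  refine h.congr_deriv ?_
  rw [dMuu, dMuv]
  ring

/-- Up to the factor `√(1 - s²)`, both sides are the joint density of the pair, with exponent `-(a²
- 2sab + b²) / (2(1 - s²))`. -/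
theorem gaussDensity_mul_comm {s : ℝ} (hs : s ∈ Ioo (-1 : ℝ) 1) (a b : ℝ) :
    gaussDensity ((b - s * a) / √(1 - s ^ 2)) * gaussDensity a =
      gaussDensity ((a - s * b) / √(1 - s ^ 2)) * gaussDensity b := by
  have hσ : 0 < 1 - s ^ 2 := by nlinarith [hs.1, hs.2]
  simp only [gaussDensity_eq, div_pow, Real.sq_sqrt hσ.le]
  rw [mul_mul_mul_comm, mul_mul_mul_comm _ _ _ (Real.exp (-b ^ 2 / 2)), ← Real.exp_add, ← Real.exp_add]
  congr 2
  field_simp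
  ring

theorem dMuv_comm {s : ℝ} (hs : s ∈ Ioo (-1 : ℝ) 1) (u v : ℝ) : dMuv s u v = dMuv s v u := by
  have h := gaussDensity_mul_comm hs (quantile u) (quantile v)
  rw [dMuv, dMuv, div_eq_div_iff (gaussDensity_pos _).ne' (gaussDensity_pos _).ne']
  linear_combination (√(1 - s ^ 2))⁻¹ * h

theorem dMuv_nonneg (s u v : ℝ) : 0 ≤ dMuv s u v := by
  rw [dMuv]
  have := gaussDensity_pos ((quantile v - s * quantile u) / √(1 - s ^ 2))
  have := gaussDensity_pos (quantile v)
  positivity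

/-- The weighted Hessian of `M` is negative semidefinite. -/
theorem dM_form_nonpos {s : ℝ} (hs : s ∈ Ioo (0 : ℝ) 1) (u v x y : ℝ) :
    dMuu s u v * x ^ 2 + 2 * s * dMuv s u v * (x * y) + dMuu s v u * y ^ 2 ≤ 0 := by
  have hs' : s ∈ Ioo (-1 : ℝ) 1 := ⟨by linarith [hs.1], hs.2⟩
  have h := gaussDensity_mul_comm hs' (quantile u) (quantile v)
  have h1 := gaussDensity_pos (quantile u)
  have h2 := gaussDensity_pos (quantile v)
  have h3 := gaussDensity_pos ((quantile v - s * quantile u) / √(1 - s ^ 2))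
  rw [dMuu, dMuu, dMuv]
  set a := gaussDensity (quantile u)
  set b := gaussDensity (quantile v)
  set p := gaussDensity ((quantile v - s * quantile u) / √(1 - s ^ 2))
  set q := gaussDensity ((quantile u - s * quantile v) / √(1 - s ^ 2))
  set σ := √(1 - s ^ 2)
  have hσ : 0 ≤ σ⁻¹ := inv_nonneg.2 (Real.sqrt_nonneg _)
  have hq : q = p * a / b := by rw [eq_div_iff h2.ne', ← h]
  -- The extra weight `s` on the mixed term is exactly what completes the square; the form
  -- degenerates along `x / a = y / b`.
  have : -(s / σ) * p / a * x ^ 2 + 2 * s * (σ⁻¹ * p / b) * (x * y) + -(s / σ) * q / b * y ^ 2 =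
      -(s * σ⁻¹ * p * a * (x / a - y / b) ^ 2) := by
    rw [hq, div_eq_mul_inv s]
    field_simp
    ring
  rw [this]
  have := hs.1
  have : 0 ≤ s * σ⁻¹ * p * a * (x / a - y / b) ^ 2 := by positivity
  linarith

theorem contDiffOn_dMuu (s : ℝ) :
    ContDiffOn ℝ 1 (fun p : ℝ × ℝ => dMuu s p.1 p.2) (Ioo 0 1 ×ˢ Ioo 0 1) := by
  have h1 : ContDiffOn ℝ 1 (fun p : ℝ × ℝ => quantile p.1) (Ioo 0 1 ×ˢ Ioo 0 1) :=
    contDiffOn_quantile.comp contDiff_fst.contDiffOn fun p hp => hp.1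
  have h2 : ContDiffOn ℝ 1 (fun p : ℝ × ℝ => quantile p.2) (Ioo 0 1 ×ˢ Ioo 0 1) :=
    contDiffOn_quantile.comp contDiff_snd.contDiffOn fun p hp => hp.2
  exact (contDiffOn_const.mul (contDiff_gaussDensity.comp_contDiffOn
    ((h2.sub (contDiffOn_const.mul h1)).div_const _))).div
    (contDiff_gaussDensity.comp_contDiffOn h1) fun p _ => (gaussDensity_pos _).ne'

theorem contDiffOn_dMuv (s : ℝ) :
    ContDiffOn ℝ 1 (fun p : ℝ × ℝ => dMuv s p.1 p.2) (Ioo 0 1 ×ˢ Ioo 0 1) := by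
  have h1 : ContDiffOn ℝ 1 (fun p : ℝ × ℝ => quantile p.1) (Ioo 0 1 ×ˢ Ioo 0 1) :=
    contDiffOn_quantile.comp contDiff_fst.contDiffOn fun p hp => hp.1
  have h2 : ContDiffOn ℝ 1 (fun p : ℝ × ℝ => quantile p.2) (Ioo 0 1 ×ˢ Ioo 0 1) :=
    contDiffOn_quantile.comp contDiff_snd.contDiffOn fun p hp => hp.2
  exact (contDiffOn_const.mul (contDiff_gaussDensity.comp_contDiffOn
    ((h2.sub (contDiffOn_const.mul h1)).div_const _))).div
    (contDiff_gaussDensity.comp_contDiffOn h2) fun p _ => (gaussDensity_pos _).ne'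

/-- The derivative of `quantile` blows up at `0` and `1`; uniform constants come from compactness of
a square away from the boundary. -/
theorem exists_bound_lipschitz_of_contDiffOn {f : ℝ × ℝ → ℝ}
    (hf : ContDiffOn ℝ 1 f (Ioo 0 1 ×ˢ Ioo 0 1)) {ε : ℝ} (hε : 0 < ε) :
    ∃ K, 0 ≤ K ∧ (∀ p ∈ Icc ε (1 - ε) ×ˢ Icc ε (1 - ε), |f p| ≤ K) ∧
      ∀ p ∈ Icc ε (1 - ε) ×ˢ Icc ε (1 - ε), ∀ q ∈ Icc ε (1 - ε) ×ˢ Icc ε (1 - ε),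
        |f p - f q| ≤ K * (|p.1 - q.1| + |p.2 - q.2|) := by
  have hsub : Icc ε (1 - ε) ⊆ Ioo (0 : ℝ) 1 := fun x hx => ⟨by linarith [hx.1], by linarith [hx.2]⟩
  have hf' := hf.mono (prod_mono hsub hsub)
  have hcomp : IsCompact (Icc ε (1 - ε) ×ˢ Icc ε (1 - ε)) := isCompact_Icc.prod isCompact_Icc
  obtain ⟨K₁, hK₁⟩ := hf'.exists_lipschitzOnWith one_ne_zero
    ((convex_Icc _ _).prod (convex_Icc _ _)) hcomp
  obtain ⟨K₂, hK₂⟩ := hcomp.exists_bound_of_continuousOn hf'.continuousOn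
  refine ⟨max K₁ K₂, le_max_of_le_left K₁.2, fun p hp => (hK₂ p hp).trans (le_max_right _ _),
    fun p hp q hq => ?_⟩
  have h := hK₁.dist_le_mul p hp q hq
  rw [Real.dist_eq, Prod.dist_eq, Real.dist_eq, Real.dist_eq] at h
  refine h.trans (mul_le_mul (le_max_left _ _) (max_le_add_of_nonneg (abs_nonneg _) (abs_nonneg _))
    (by positivity) (le_max_of_le_left K₁.2))

/-- Subtracting the cubic Taylor majorant leaves an antitone function, first for `ψ₁` and then for
`ψ`; a one-sided bound on the second derivative suffices. -/
theorem taylor_two_le_of_deriv_lipschitz {ψ ψ₁ ψ₂ : ℝ → ℝ} {K : ℝ}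
    (h₁ : ∀ t ∈ Icc (0 : ℝ) 1, HasDerivAt ψ (ψ₁ t) t)
    (h₂ : ∀ t ∈ Icc (0 : ℝ) 1, HasDerivAt ψ₁ (ψ₂ t) t)
    (hK : ∀ t ∈ Icc (0 : ℝ) 1, ψ₂ t ≤ ψ₂ 0 + K * t) :
    ψ 1 ≤ ψ 0 + ψ₁ 0 + ψ₂ 0 / 2 + K / 6 := by
  have h0 : (0 : ℝ) ∈ Icc (0 : ℝ) 1 := by simp
  have hd2 : ∀ t ∈ Icc (0 : ℝ) 1, HasDerivAt (fun t => ψ₁ t - ψ₂ 0 * t - K * t ^ 2 / 2)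
      (ψ₂ t - ψ₂ 0 - K * t) t := fun t ht => by
    have := ((h₂ t ht).sub ((hasDerivAt_id t).const_mul (ψ₂ 0))).sub
      ((((hasDerivAt_id t).pow 2).const_mul K).div_const 2)
    refine this.congr_deriv ?_
    simp
    ring
  have ha : AntitoneOn (fun t => ψ₁ t - ψ₂ 0 * t - K * t ^ 2 / 2) (Icc 0 1) := by
    refine antitoneOn_of_deriv_nonpos (convex_Icc _ _)
      (fun t ht => (hd2 t ht).continuousAt.continuousWithinAt)
      (fun t ht => (hd2 t (interior_subset ht)).differentiableAt.differentiableWithinAt)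
      fun t ht => ?_
    rw [(hd2 t (interior_subset ht)).deriv]
    linarith [hK t (interior_subset ht)]
  have hd1 : ∀ t ∈ Icc (0 : ℝ) 1,
      HasDerivAt (fun t => ψ t - ψ₁ 0 * t - ψ₂ 0 * t ^ 2 / 2 - K * t ^ 3 / 6)
      (ψ₁ t - ψ₁ 0 - ψ₂ 0 * t - K * t ^ 2 / 2) t := fun t ht => by
    have := (((h₁ t ht).sub ((hasDerivAt_id t).const_mul (ψ₁ 0))).sub
      ((((hasDerivAt_id t).pow 2).const_mul (ψ₂ 0)).div_const 2)).sub
      ((((hasDerivAt_id t).pow 3).const_mul K).div_const 6)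
    refine this.congr_deriv ?_
    simp
    ring
  have hb : AntitoneOn (fun t => ψ t - ψ₁ 0 * t - ψ₂ 0 * t ^ 2 / 2 - K * t ^ 3 / 6) (Icc 0 1) := by
    refine antitoneOn_of_deriv_nonpos (convex_Icc _ _)
      (fun t ht => (hd1 t ht).continuousAt.continuousWithinAt)
      (fun t ht => (hd1 t (interior_subset ht)).differentiableAt.differentiableWithinAt)
      fun t ht => ?_
    rw [(hd1 t (interior_subset ht)).deriv]
    have := ha h0 (interior_subset ht) (interior_subset ht).1
    simp only at this
    linarith
  have := hb h0 (by simp) zero_le_one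
  simp only at this
  linarith

/-- A function of two variables has, on the square `[ε, 1 - ε]²`, uniform quadratic upper
expansions whose second-order part, weighted by the correlation `s`, is nonpositive. -/
def HasConcaveExpansion (s ε K : ℝ) (F : ℝ → ℝ → ℝ) : Prop :=
  ∀ u ∈ Icc ε (1 - ε), ∀ v ∈ Icc ε (1 - ε), ∃ α β p q r : ℝ,
    |p| ≤ K ∧ |q| ≤ K ∧ |r| ≤ K ∧ 0 ≤ q ∧
    (∀ x y : ℝ, p * x ^ 2 + 2 * s * q * (x * y) + r * y ^ 2 ≤ 0) ∧
    ∀ u' ∈ Icc ε (1 - ε), ∀ v' ∈ Icc ε (1 - ε),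
      F u' v' ≤ F u v + α * (u' - u) + β * (v' - v) +
        (p * (u' - u) ^ 2 + 2 * q * ((u' - u) * (v' - v)) + r * (v' - v) ^ 2) / 2 +
        K * (|u' - u| + |v' - v|) ^ 3

/-- Taylor's formula along segments. The sign condition carries a factor `s` that the expansion
lacks, since averaging over an `s`-correlated pair multiplies the mixed term by `s`. -/
theorem exists_hasConcaveExpansion_M {s ε : ℝ} (hs : s ∈ Ioo (0 : ℝ) 1) (hε : 0 < ε) :
    ∃ K, 0 ≤ K ∧ HasConcaveExpansion s ε K (fun u v => M u v s) := by
  have hs' : s ∈ Ioo (-1 : ℝ) 1 := ⟨by linarith [hs.1], hs.2⟩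
  obtain ⟨K₁, hK₁, hb₁, hl₁⟩ := exists_bound_lipschitz_of_contDiffOn (contDiffOn_dMuu s) hε
  obtain ⟨K₂, hK₂, hb₂, hl₂⟩ := exists_bound_lipschitz_of_contDiffOn (contDiffOn_dMuv s) hε
  have hsub : Icc ε (1 - ε) ⊆ Ioo (0 : ℝ) 1 := fun x hx => ⟨by linarith [hx.1], by linarith [hx.2]⟩
  refine ⟨K₁ + K₂, by positivity, fun u hu v hv => ⟨dM s u v, dM s v u, dMuu s u v, dMuv s u v,
    dMuu s v u, (hb₁ (u, v) ⟨hu, hv⟩).trans (by linarith),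
    (hb₂ (u, v) ⟨hu, hv⟩).trans (by linarith), (hb₁ (v, u) ⟨hv, hu⟩).trans (by linarith),
    dMuv_nonneg s u v, dM_form_nonpos hs u v, fun u' hu' v' hv' => ?_⟩⟩
  set ξ := u' - u with hξ
  set η := v' - v with hη
  have hseg : ∀ t ∈ Icc (0 : ℝ) 1, u + t * ξ ∈ Icc ε (1 - ε) ∧ v + t * η ∈ Icc ε (1 - ε) := by
    intro t ht
    have h1 := convex_Icc ε (1 - ε) hu hu' (sub_nonneg.2 ht.2) ht.1 (by ring)
    have h2 := convex_Icc ε (1 - ε) hv hv' (sub_nonneg.2 ht.2) ht.1 (by ring)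
    simp only [smul_eq_mul] at h1 h2
    refine ⟨?_, ?_⟩
    · convert h1 using 1; rw [hξ]; ring
    · convert h2 using 1; rw [hη]; ring
  have hd1 : ∀ t ∈ Icc (0 : ℝ) 1, HasDerivAt (fun t => M (u + t * ξ) (v + t * η) s)
      (ξ * dM s (u + t * ξ) (v + t * η) + η * dM s (v + t * η) (u + t * ξ)) t := fun t ht =>
    hasDerivAt_segment_M hs' (hsub (hseg t ht).1) (hsub (hseg t ht).2)
  have hd2 : ∀ t ∈ Icc (0 : ℝ) 1, HasDerivAt
      (fun t => ξ * dM s (u + t * ξ) (v + t * η) + η * dM s (v + t * η) (u + t * ξ))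
      (dMuu s (u + t * ξ) (v + t * η) * ξ ^ 2 + 2 * dMuv s (u + t * ξ) (v + t * η) * (ξ * η) +
        dMuu s (v + t * η) (u + t * ξ) * η ^ 2) t := fun t ht => by
    have h := ((hasDerivAt_segment_dM (s := s) (hsub (hseg t ht).1)
      (hsub (hseg t ht).2)).const_mul ξ).add
      ((hasDerivAt_segment_dM (s := s) (hsub (hseg t ht).2) (hsub (hseg t ht).1)).const_mul η)
    refine h.congr_deriv ?_
    rw [dMuv_comm hs' (v + t * η)]
    ring
  have hmain := taylor_two_le_of_deriv_lipschitz hd1 hd2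
    -- Any factor from `1` to `6` would do in place of `4`: the Lipschitz bounds need at least `1`,
    -- and Taylor's formula divides by `6`.
    (K := 4 * (K₁ + K₂) * (|ξ| + |η|) ^ 3) (fun t ht => by
      obtain ⟨hut, hvt⟩ := hseg t ht
      have e1 := hl₁ (u + t * ξ, v + t * η) ⟨hut, hvt⟩ (u, v) ⟨hu, hv⟩
      have e2 := hl₂ (u + t * ξ, v + t * η) ⟨hut, hvt⟩ (u, v) ⟨hu, hv⟩
      have e3 := hl₁ (v + t * η, u + t * ξ) ⟨hvt, hut⟩ (v, u) ⟨hv, hu⟩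
      simp only [add_sub_cancel_left, abs_mul, abs_of_nonneg ht.1] at e1 e2 e3
      simp only [zero_mul, add_zero]
      have b1 : (dMuu s (u + t * ξ) (v + t * η) - dMuu s u v) * ξ ^ 2 ≤
          K₁ * (t * |ξ| + t * |η|) * |ξ| ^ 2 := by
        rw [sq_abs]
        exact mul_le_mul_of_nonneg_right ((le_abs_self _).trans e1) (sq_nonneg _)
      have b3 : (dMuu s (v + t * η) (u + t * ξ) - dMuu s v u) * η ^ 2 ≤
          K₁ * (t * |η| + t * |ξ|) * |η| ^ 2 := by
        rw [sq_abs]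
        exact mul_le_mul_of_nonneg_right ((le_abs_self _).trans e3) (sq_nonneg _)
      have b2 : (dMuv s (u + t * ξ) (v + t * η) - dMuv s u v) * (ξ * η) ≤
          K₂ * (t * |ξ| + t * |η|) * (|ξ| * |η|) := by
        refine (le_abs_self _).trans ?_
        rw [abs_mul, abs_mul]
        exact mul_le_mul_of_nonneg_right e2 (by positivity)
      have hx := abs_nonneg ξ
      have hy := abs_nonneg η
      set x := |ξ|
      set y := |η|
      have hfin : K₁ * (t * x + t * y) * x ^ 2 + 2 * (K₂ * (t * x + t * y) * (x * y)) +
          K₁ * (t * y + t * x) * y ^ 2 ≤ 4 * (K₁ + K₂) * (x + y) ^ 3 * t := by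
        have ht0 := ht.1
        have : 4 * (K₁ + K₂) * (x + y) ^ 3 * t - (K₁ * (t * x + t * y) * x ^ 2 +
            2 * (K₂ * (t * x + t * y) * (x * y)) + K₁ * (t * y + t * x) * y ^ 2) =
            t * (x + y) * (3 * K₁ * (x ^ 2 + y ^ 2) + 8 * K₁ * (x * y) +
              4 * K₂ * (x ^ 2 + y ^ 2) + 6 * K₂ * (x * y)) := by ring
        have h0 : 0 ≤ t * (x + y) * (3 * K₁ * (x ^ 2 + y ^ 2) + 8 * K₁ * (x * y) +
              4 * K₂ * (x ^ 2 + y ^ 2) + 6 * K₂ * (x * y)) := by positivity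
        linarith
      linarith)
  simp only [zero_mul, add_zero, one_mul] at hmain
  have e1 : u + ξ = u' := by rw [hξ]; ring
  have e2 : v + η = v' := by rw [hη]; ring
  rw [e1, e2] at hmain
  have h0 : 0 ≤ (K₁ + K₂) * (|ξ| + |η|) ^ 3 := by positivity
  linarith

end BivariateM

/-! ### Gaussian averaging and the functional inequality. -/

section Semigroup

open Filter Topology

variable {E : Type*} [NormedAddCommGroup E] [InnerProductSpace ℝ E]

/-- `f` takes values in `[ε, 1 - ε]` and has uniform first-order expansions with constant `L`. -/
structure IsRegular [MeasurableSpace E] (L ε : ℝ) (f : E → ℝ) : Prop where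
  measurable : Measurable f
  mem_Icc : ∀ x, f x ∈ Icc ε (1 - ε)
  expansion : ∃ d : E → E, Measurable d ∧ (∀ x, ‖d x‖ ≤ L) ∧
    ∀ x h, |f (x + h) - f x - inner ℝ (d x) h| ≤ L * ‖h‖ ^ 2

variable [FiniteDimensional ℝ E] [MeasurableSpace E] [BorelSpace E]

/-- The average of `f` over a centred Gaussian of variance `t`. -/
noncomputable def gaussAverage (t : ℝ) (f : E → ℝ) (x : E) : ℝ :=
  ∫ z, f (x + √t • z) ∂(stdGaussian E)

theorem integrable_of_measurable_of_mem_Icc {α : Type*} [MeasurableSpace α] {μ : Measure α}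
    [IsFiniteMeasure μ] {f : α → ℝ} (hf : Measurable f) {a b : ℝ} (h : ∀ x, f x ∈ Icc a b) :
    Integrable f μ :=
  Integrable.of_mem_Icc a b hf.aemeasurable (Eventually.of_forall h)

theorem integral_mem_Icc {α : Type*} [MeasurableSpace α] {μ : Measure α}
    [IsProbabilityMeasure μ] {f : α → ℝ} (hf : Measurable f) {a b : ℝ} (h : ∀ x, f x ∈ Icc a b) :
    ∫ x, f x ∂μ ∈ Icc a b := by
  have hi := integrable_of_measurable_of_mem_Icc (μ := μ) hf h
  constructor
  · have := integral_mono (integrable_const a) hi fun x => (h x).1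
    simpa using this
  · have := integral_mono hi (integrable_const b) fun x => (h x).2
    simpa using this

/-- Averaging the field `d` along with `f` preserves every bound with the same constants. Regularity
is phrased by such a field so that no differentiation under the integral is needed. -/
theorem IsRegular.gaussAverage {L ε : ℝ} {f : E → ℝ} (hf : IsRegular L ε f) (t : ℝ) :
    IsRegular L ε (gaussAverage t f) := by
  obtain ⟨d, hd, hdL, hexp⟩ := hf.expansion
  have hmeas : ∀ x, Measurable fun z : E => f (x + √t • z) := fun x =>
    hf.measurable.comp (by fun_prop)
  have hdmeas : ∀ x, Measurable fun z : E => d (x + √t • z) := fun x => hd.comp (by fun_prop)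
  have hfint : ∀ x, Integrable (fun z : E => f (x + √t • z)) (stdGaussian E) := fun x =>
    integrable_of_measurable_of_mem_Icc (hmeas x) fun z => hf.mem_Icc _
  have hdint : ∀ x, Integrable (fun z : E => d (x + √t • z)) (stdGaussian E) := fun x =>
    Integrable.of_bound (C := L) (hdmeas x).aestronglyMeasurable
      (Eventually.of_forall fun z => hdL _)
  refine ⟨?_, fun x => integral_mem_Icc (hmeas x) fun z => hf.mem_Icc _,
    fun x => ∫ z, d (x + √t • z) ∂(stdGaussian E), ?_, fun x => ?_, fun x h => ?_⟩
  · have : StronglyMeasurable fun p : E × E => f (p.1 + √t • p.2) :=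
      (hf.measurable.comp (by fun_prop)).stronglyMeasurable
    exact this.integral_prod_right'.measurable
  · have : StronglyMeasurable fun p : E × E => d (p.1 + √t • p.2) :=
      (hd.comp (by fun_prop)).stronglyMeasurable
    exact this.integral_prod_right'.measurable
  · refine (norm_integral_le_of_norm_le_const (C := L) (Eventually.of_forall fun z => hdL _)).trans ?_
    simp
  · have h1 : NoisyBorell.gaussAverage t f (x + h) - NoisyBorell.gaussAverage t f x -
        inner ℝ (∫ z, d (x + √t • z) ∂(stdGaussian E)) h =
        ∫ z, (f (x + √t • z + h) - f (x + √t • z) - inner ℝ (d (x + √t • z)) h)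
          ∂(stdGaussian E) := by
      have e1 : (fun z : E => f (x + √t • z + h)) = fun z => f (x + h + √t • z) := by
        ext z; congr 1; abel
      have i1 : Integrable (fun z : E => f (x + √t • z + h)) (stdGaussian E) := by
        rw [e1]; exact hfint _
      have i2 : Integrable (fun z : E => inner ℝ (d (x + √t • z)) h) (stdGaussian E) :=
        (hdint x).inner_const h
      have i3 : Integrable (fun z : E => f (x + √t • z + h) - f (x + √t • z)) (stdGaussian E) :=
        i1.sub (hfint x)
      rw [integral_sub i3 i2, integral_sub i1 (hfint x), e1,
        real_inner_comm, ← integral_inner (hdint x)]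
      simp_rw [real_inner_comm h]
      rfl
    rw [h1, ← Real.norm_eq_abs]
    refine (norm_integral_le_of_norm_le_const (C := L * ‖h‖ ^ 2)
      (Eventually.of_forall fun z => hexp _ _)).trans ?_
    simp

theorem gaussAverage_gaussAverage {f : E → ℝ} (hf : Measurable f) {C : ℝ} (hC : ∀ x, |f x| ≤ C)
    {h r : ℝ} (hh : 0 ≤ h) (hr : 0 ≤ r) :
    gaussAverage h (gaussAverage r f) = gaussAverage (h + r) f := by
  ext x
  exact integral_integral_add_of_centered (by simp) hf hC
    hh hr x

theorem integrable_norm_pow_stdGaussian (k : ℕ) :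
    Integrable (fun x : E => ‖x‖ ^ k) (stdGaussian E) := by
  have h := IsGaussian.memLp_id (stdGaussian E) k (by simp)
  exact h.integrable_norm_pow'

theorem integrable_norm_pow_gaussPair (s : ℝ) (k : ℕ) :
    Integrable (fun x : E × E => ‖x‖ ^ k) (gaussPair E s) := by
  have h := IsGaussian.memLp_id (gaussPair E s) k (by simp)
  exact h.integrable_norm_pow'

theorem integrable_fst_gaussPair (s : ℝ) {f : E → ℝ} (hf : Integrable f (stdGaussian E)) :
    Integrable (fun p : E × E => f p.1) (gaussPair E s) := by
  rw [← gaussPair_map_fst s] at hf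
  exact hf.comp_measurable measurable_fst

theorem integrable_snd_gaussPair {s : ℝ} (hs : s ∈ Icc (-1 : ℝ) 1) {f : E → ℝ}
    (hf : Integrable f (stdGaussian E)) :
    Integrable (fun p : E × E => f p.2) (gaussPair E s) := by
  rw [← gaussPair_map_snd hs] at hf
  exact hf.comp_measurable measurable_snd

theorem integral_fst_gaussPair (s : ℝ) {f : E → ℝ} (hf : AEStronglyMeasurable f (stdGaussian E)) :
    ∫ p, f p.1 ∂(gaussPair E s) = ∫ x, f x ∂(stdGaussian E) := by
  rw [← gaussPair_map_fst s] at hf ⊢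
  rw [integral_map (by fun_prop) hf]

theorem integral_snd_gaussPair {s : ℝ} (hs : s ∈ Icc (-1 : ℝ) 1) {f : E → ℝ}
    (hf : AEStronglyMeasurable f (stdGaussian E)) :
    ∫ p, f p.2 ∂(gaussPair E s) = ∫ x, f x ∂(stdGaussian E) := by
  rw [← gaussPair_map_snd hs] at hf ⊢
  rw [integral_map (by fun_prop) hf]

/-- The increment of a regular function about its Gaussian average is linear up to second order. -/
theorem IsRegular.exists_increment_bound {L ε : ℝ} {f : E → ℝ}
    (hf : IsRegular L ε f) (x : E) {h : ℝ} (hh : 0 ≤ h) :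
    ∃ d : E, ‖d‖ ≤ L ∧ ∀ z : E, |f (x + √h • z) - NoisyBorell.gaussAverage h f x -
      √h * inner ℝ d z| ≤ L * h * ((∫ w, ‖w‖ ^ 2 ∂(stdGaussian E)) + ‖z‖ ^ 2) := by
  obtain ⟨d, hd, hdL, hexp⟩ := hf.expansion
  refine ⟨d x, hdL x, fun z => ?_⟩
  have hpt : ∀ z : E, |f (x + √h • z) - f x - √h * inner ℝ (d x) z| ≤ L * h * ‖z‖ ^ 2 := by
    intro z
    have := hexp x (√h • z)
    rw [inner_smul_right, norm_smul, mul_pow, Real.norm_eq_abs, sq_abs, Real.sq_sqrt hh] at this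
    linarith
  have hfint : Integrable (fun z : E => f (x + √h • z)) (stdGaussian E) :=
    integrable_of_measurable_of_mem_Icc (hf.measurable.comp (by fun_prop)) fun z => hf.mem_Icc _
  have hint : Integrable (fun z : E => √h * inner ℝ (d x) z) (stdGaussian E) :=
    ((memLp_two_inner_stdGaussian (d x)).integrable (by norm_num)).const_mul _
  -- The linear term has mean zero, so replacing `f x` by the average costs only order `h`.
  have hmean : NoisyBorell.gaussAverage h f x - f x =
      ∫ z, (f (x + √h • z) - f x - √h * inner ℝ (d x) z) ∂(stdGaussian E) := by
    have i1 : Integrable (fun z : E => f (x + √h • z) - f x) (stdGaussian E) :=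
      hfint.sub (integrable_const _)
    rw [integral_sub i1 hint, integral_sub hfint (integrable_const _), integral_const_mul,
      integral_inner_stdGaussian]
    simp [NoisyBorell.gaussAverage]
  have hb : |NoisyBorell.gaussAverage h f x - f x| ≤ L * h * ∫ w, ‖w‖ ^ 2 ∂(stdGaussian E) := by
    rw [hmean, ← integral_const_mul, ← Real.norm_eq_abs]
    exact norm_integral_le_of_norm_le ((integrable_norm_pow_stdGaussian 2).const_mul _)
      (Eventually.of_forall hpt)
  have h1 := hpt z
  have h2 : f (x + √h • z) - NoisyBorell.gaussAverage h f x - √h * inner ℝ (d x) z =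
      (f (x + √h • z) - f x - √h * inner ℝ (d x) z) -
        (NoisyBorell.gaussAverage h f x - f x) := by ring
  rw [h2]
  refine (abs_sub _ _).trans ?_
  linarith

/-- Here `τ` stands for `√h`, `ξ₀` and `η₀` for the linear parts (order `τ`) of the increments `ξ`
and `η`, which differ from them by order `τ²`. In the quadratic term the exchange costs order `τ³`,
like the cubic remainder. -/
theorem expansion_remainder_le {K L R τ p q r ξ η ξ₀ η₀ : ℝ} (hK : 0 ≤ K) (hL : 0 ≤ L)
    (hR : 1 ≤ R) (hτ : 0 ≤ τ) (hτ1 : τ ≤ 1) (hp : |p| ≤ K) (hq : |q| ≤ K) (hr : |r| ≤ K)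
    (hξ₀ : |ξ₀| ≤ L * τ * R) (hη₀ : |η₀| ≤ L * τ * R)
    (hξ : |ξ - ξ₀| ≤ L * τ ^ 2 * R) (hη : |η - η₀| ≤ L * τ ^ 2 * R) :
    (p * ξ ^ 2 + 2 * q * (ξ * η) + r * η ^ 2) / 2 + K * (|ξ| + |η|) ^ 3 ≤
      (p * ξ₀ ^ 2 + 2 * q * (ξ₀ * η₀) + r * η₀ ^ 2) / 2 +
        K * (6 * L ^ 2 + 64 * L ^ 3) * R ^ 3 * τ ^ 3 := by
  have hLτR : L * τ ^ 2 * R ≤ L * τ * R := by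
    have : τ ^ 2 ≤ τ := by nlinarith
    gcongr
  have hξ1 : |ξ| ≤ 2 * (L * τ * R) := by
    have := abs_add_le (ξ - ξ₀) ξ₀
    rw [sub_add_cancel] at this
    linarith
  have hη1 : |η| ≤ 2 * (L * τ * R) := by
    have := abs_add_le (η - η₀) η₀
    rw [sub_add_cancel] at this
    linarith
  -- To be used with `ξη - ξ₀η₀ = (ξ - ξ₀)η + ξ₀(η - η₀)` and its two diagonal analogues. The three
  -- bounds add up to the `6`; the `64` is `4³`.
  have hprod : ∀ {a b c d : ℝ}, |a| ≤ L * τ ^ 2 * R → |b| ≤ 2 * (L * τ * R) →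
      |c| ≤ L * τ * R → |d| ≤ L * τ ^ 2 * R → ∀ {e : ℝ}, |e| ≤ K →
      e * (a * b + c * d) ≤ K * (3 * L ^ 2 * R ^ 2 * τ ^ 3) := by
    intro a b c d ha hb hc hd e he
    have h1 : |a * b| ≤ (L * τ ^ 2 * R) * (2 * (L * τ * R)) := by
      rw [abs_mul]; gcongr
    have h2 : |c * d| ≤ (L * τ * R) * (L * τ ^ 2 * R) := by
      rw [abs_mul]; gcongr
    have h3 : |a * b + c * d| ≤ 3 * L ^ 2 * R ^ 2 * τ ^ 3 := by
      refine (abs_add_le _ _).trans ((add_le_add h1 h2).trans (le_of_eq ?_))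
      ring
    refine (le_abs_self _).trans ?_
    rw [abs_mul]
    gcongr
  have c1 := hprod hξ hξ1 hξ₀ hξ hp
  have c2 := hprod hξ hη1 hξ₀ hη hq
  have c3 := hprod hη hη1 hη₀ hη hr
  have hquad : (p * ξ ^ 2 + 2 * q * (ξ * η) + r * η ^ 2) / 2 -
      (p * ξ₀ ^ 2 + 2 * q * (ξ₀ * η₀) + r * η₀ ^ 2) / 2 ≤ K * (6 * L ^ 2 * R ^ 2 * τ ^ 3) := by
    linarith
  have hcub : K * (|ξ| + |η|) ^ 3 ≤ K * (64 * L ^ 3 * R ^ 3 * τ ^ 3) := by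
    have : (|ξ| + |η|) ^ 3 ≤ (2 * (L * τ * R) + 2 * (L * τ * R)) ^ 3 := by gcongr
    refine (mul_le_mul_of_nonneg_left this hK).trans (le_of_eq ?_)
    ring
  have hR23 : K * (6 * L ^ 2 * R ^ 2 * τ ^ 3) ≤ K * (6 * L ^ 2 * R ^ 3 * τ ^ 3) := by
    have : R ^ 2 ≤ R ^ 3 := pow_le_pow_right₀ hR (by norm_num)
    gcongr
  linarith

/-- One small step of the semigroup increases the functional at most by a third-order term. -/
theorem exists_step_bound {s ε K L : ℝ} (hs : s ∈ Ioo (0 : ℝ) 1) (hK : 0 ≤ K) (hL : 0 ≤ L)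
    {F : ℝ → ℝ → ℝ} (hF : HasConcaveExpansion s ε K F)
    (hFm : Measurable fun p : ℝ × ℝ => F p.1 p.2) (hF01 : ∀ u v, F u v ∈ Icc (0 : ℝ) 1) :
    ∃ C, 0 ≤ C ∧ ∀ f g : E → ℝ, IsRegular L ε f → IsRegular L ε g → ∀ x y : E,
      ∀ h ∈ Icc (0 : ℝ) 1,
        ∫ p, F (f (x + √h • p.1)) (g (y + √h • p.2)) ∂(gaussPair E s) ≤
          F (gaussAverage h f x) (gaussAverage h g y) + C * √h ^ 3 := by
  have hs' : s ∈ Icc (-1 : ℝ) 1 := ⟨by linarith [hs.1], hs.2.le⟩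
  set m := ∫ w : E, ‖w‖ ^ 2 ∂(stdGaussian E) with hm
  have hm0 : 0 ≤ m := integral_nonneg fun w => by positivity
  -- One weight dominating `1`, `‖p‖` and `m + ‖p‖²`, with integrable cube.
  set R : E × E → ℝ := fun p => 1 + m + 2 * ‖p‖ ^ 2 with hR
  have hR1 : ∀ p, 1 ≤ R p := fun p => by
    have : 0 ≤ 2 * ‖p‖ ^ 2 := by positivity
    simp only [hR]; linarith
  have hRint : Integrable (fun p => R p ^ 3) (gaussPair E s) := by
    have : (fun p => R p ^ 3) = fun p : E × E => (1 + m) ^ 3 + 6 * (1 + m) ^ 2 * ‖p‖ ^ 2 +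
        12 * (1 + m) * ‖p‖ ^ 4 + 8 * ‖p‖ ^ 6 := by
      ext p; simp only [hR]; ring
    rw [this]
    exact (((integrable_const _).add ((integrable_norm_pow_gaussPair s 2).const_mul _)).add
      ((integrable_norm_pow_gaussPair s 4).const_mul _)).add
      ((integrable_norm_pow_gaussPair s 6).const_mul _)
  refine ⟨K * (6 * L ^ 2 + 64 * L ^ 3) * ∫ p, R p ^ 3 ∂(gaussPair E s), ?_, ?_⟩
  · have : 0 ≤ ∫ p, R p ^ 3 ∂(gaussPair E s) := integral_nonneg fun p =>
      pow_nonneg (zero_le_one.trans (hR1 p)) 3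
    positivity
  intro f g hf hg x y h hh
  set a := gaussAverage h f x with ha
  set b := gaussAverage h g y with hb
  set τ := √h with hτ
  have hτ0 : 0 ≤ τ := Real.sqrt_nonneg _
  have hτ1 : τ ≤ 1 := Real.sqrt_le_one.2 hh.2
  have hτ2 : τ ^ 2 = h := Real.sq_sqrt hh.1
  obtain ⟨α, β, p, q, r, hp, hq, hr, hq0, hform, hbound⟩ :=
    hF a ((hf.gaussAverage h).mem_Icc x) b ((hg.gaussAverage h).mem_Icc y)
  obtain ⟨d, hd, hdb⟩ := hf.exists_increment_bound x hh.1
  obtain ⟨e, he, heb⟩ := hg.exists_increment_bound y hh.1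
  have hlin : ∀ {c z : E} {P : E × E}, ‖c‖ ≤ L → ‖z‖ ≤ ‖P‖ → |τ * inner ℝ c z| ≤ L * τ * R P := by
    intro c z P hc hz
    have h1 : |inner ℝ c z| ≤ L * R P := by
      refine (abs_real_inner_le_norm c z).trans ?_
      have : ‖z‖ ≤ R P := by
        simp only [hR]
        nlinarith [sq_nonneg (‖P‖ - 1), norm_nonneg P]
      gcongr
    rw [abs_mul, abs_of_nonneg hτ0]
    calc τ * |inner ℝ c z| ≤ τ * (L * R P) := by gcongr
      _ = _ := by ring
  have hquad : ∀ {z : E} {P : E × E}, ‖z‖ ≤ ‖P‖ → L * h * (m + ‖z‖ ^ 2) ≤ L * τ ^ 2 * R P := by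
    intro z P hz
    rw [hτ2]
    have h1 : ‖z‖ ^ 2 ≤ ‖P‖ ^ 2 := by gcongr
    have h2 : 0 ≤ ‖P‖ ^ 2 := by positivity
    have h3 : m + ‖z‖ ^ 2 ≤ R P := by simp only [hR]; linarith
    have h4 : 0 ≤ L * h := mul_nonneg hL hh.1
    gcongr
  set Q : E × E → ℝ := fun P => p * inner ℝ d P.1 ^ 2 + 2 * q * (inner ℝ d P.1 * inner ℝ e P.2) +
    r * inner ℝ e P.2 ^ 2 with hQ
  have hpt : ∀ P : E × E, F (f (x + τ • P.1)) (g (y + τ • P.2)) ≤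
      F a b + α * (f (x + τ • P.1) - a) + β * (g (y + τ • P.2) - b) + h / 2 * Q P +
        K * (6 * L ^ 2 + 64 * L ^ 3) * τ ^ 3 * R P ^ 3 := by
    intro P
    have h1 := hbound _ (hf.mem_Icc (x + τ • P.1)) _ (hg.mem_Icc (y + τ • P.2))
    have h2 := expansion_remainder_le hK hL (hR1 P) hτ0 hτ1 hp hq hr
      (hlin hd (norm_fst_le P)) (hlin he (norm_snd_le P))
      ((hdb P.1).trans (hquad (norm_fst_le P))) ((heb P.2).trans (hquad (norm_snd_le P)))
    have h3 : (p * (τ * inner ℝ d P.1) ^ 2 + 2 * q * (τ * inner ℝ d P.1 * (τ * inner ℝ e P.2)) +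
        r * (τ * inner ℝ e P.2) ^ 2) / 2 = h / 2 * Q P := by
      simp only [hQ]; rw [← hτ2]; ring
    rw [h3] at h2
    refine h1.trans ?_
    linarith
  have hfm : Measurable fun z : E => f (x + τ • z) := hf.measurable.comp (by fun_prop)
  have hgm : Measurable fun z : E => g (y + τ • z) := hg.measurable.comp (by fun_prop)
  have hfi : Integrable (fun z : E => f (x + τ • z)) (stdGaussian E) :=
    integrable_of_measurable_of_mem_Icc hfm fun z => hf.mem_Icc _
  have hgi : Integrable (fun z : E => g (y + τ • z)) (stdGaussian E) :=
    integrable_of_measurable_of_mem_Icc hgm fun z => hg.mem_Icc _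
  have i1 : Integrable (fun P : E × E => F (f (x + τ • P.1)) (g (y + τ • P.2))) (gaussPair E s) :=
    integrable_of_measurable_of_mem_Icc
      (hFm.comp ((hfm.comp measurable_fst).prodMk (hgm.comp measurable_snd))) fun P => hF01 _ _
  have j2 : Integrable (fun z : E => α * (f (x + τ • z) - a)) (stdGaussian E) :=
    (hfi.sub (integrable_const a)).const_mul α
  have j3 : Integrable (fun z : E => β * (g (y + τ • z) - b)) (stdGaussian E) :=
    (hgi.sub (integrable_const b)).const_mul β
  have i2 := integrable_fst_gaussPair s j2
  have i3 := integrable_snd_gaussPair hs' j3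
  -- The expansion is centred at the averages and each marginal is standard, so the first-order
  -- terms vanish whatever `α` and `β` are.
  have e2 : ∫ P : E × E, α * (f (x + τ • P.1) - a) ∂(gaussPair E s) = 0 := by
    rw [integral_fst_gaussPair s (f := fun z => α * (f (x + τ • z) - a)) j2.aestronglyMeasurable,
      integral_const_mul, integral_sub hfi (integrable_const a)]
    simp [ha, gaussAverage, hτ]
  have e3 : ∫ P : E × E, β * (g (y + τ • P.2) - b) ∂(gaussPair E s) = 0 := by
    rw [integral_snd_gaussPair hs' (f := fun z => β * (g (y + τ • z) - b)) j3.aestronglyMeasurable,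
      integral_const_mul, integral_sub hgi (integrable_const b)]
    simp [hb, gaussAverage, hτ]
  have k1 : Integrable (fun P : E × E => inner ℝ d P.1 ^ 2) (gaussPair E s) :=
    integrable_fst_gaussPair s (memLp_two_inner_stdGaussian d).integrable_sq
  have k3 : Integrable (fun P : E × E => inner ℝ e P.2 ^ 2) (gaussPair E s) :=
    integrable_snd_gaussPair hs' (memLp_two_inner_stdGaussian e).integrable_sq
  have k2 : Integrable (fun P : E × E => inner ℝ d P.1 * inner ℝ e P.2) (gaussPair E s) := by
    refine Integrable.mono' (k1.add k3) (by fun_prop) (Eventually.of_forall fun P => ?_)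
    simp only [Pi.add_apply, Real.norm_eq_abs, abs_mul]
    nlinarith [sq_nonneg (|inner ℝ d P.1| - |inner ℝ e P.2|), sq_abs (inner ℝ d P.1),
      sq_abs (inner ℝ e P.2), sq_nonneg (inner ℝ d P.1), sq_nonneg (inner ℝ e P.2)]
  have i4 : Integrable Q (gaussPair E s) := ((k1.const_mul p).add (k2.const_mul _)).add
    (k3.const_mul r)
  have hsq : ∀ c : E, ∫ z, inner ℝ c z ^ 2 ∂(stdGaussian E) = ‖c‖ ^ 2 := fun c => by
    simp_rw [pow_two (inner ℝ c _)]
    rw [integral_inner_mul_inner_stdGaussian, real_inner_self_eq_norm_sq]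
  have e4 : ∫ P, Q P ∂(gaussPair E s) ≤ 0 := by
    have l12 : Integrable (fun P : E × E => p * inner ℝ d P.1 ^ 2 +
        2 * q * (inner ℝ d P.1 * inner ℝ e P.2)) (gaussPair E s) :=
      (k1.const_mul p).add (k2.const_mul _)
    simp only [hQ]
    rw [integral_add l12 (k3.const_mul r), integral_add (k1.const_mul p) (k2.const_mul _),
      integral_const_mul, integral_const_mul, integral_const_mul,
      integral_inner_mul_inner_gaussPair,
      integral_fst_gaussPair s (f := fun z => inner ℝ d z ^ 2) (by fun_prop),
      integral_snd_gaussPair hs' (f := fun z => inner ℝ e z ^ 2) (by fun_prop), hsq, hsq]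
    have h1 := hform ‖d‖ ‖e‖
    -- Cauchy–Schwarz reduces to the scalar form at `(‖d‖, ‖e‖)`; this is where `s > 0` and `q ≥ 0`
    -- enter.
    have h2 : 2 * q * (s * inner ℝ d e) ≤ 2 * s * q * (‖d‖ * ‖e‖) := by
      have := mul_le_mul_of_nonneg_left (real_inner_le_norm d e)
        (mul_nonneg (mul_nonneg zero_le_two hs.1.le) hq0)
      linarith
    linarith
  have i12 : Integrable (fun P : E × E => F a b + α * (f (x + τ • P.1) - a)) (gaussPair E s) :=
    (integrable_const _).add i2
  have i13 : Integrable (fun P : E × E => F a b + α * (f (x + τ • P.1) - a) +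
    β * (g (y + τ • P.2) - b)) (gaussPair E s) := i12.add i3
  have i14 : Integrable (fun P : E × E => F a b + α * (f (x + τ • P.1) - a) +
    β * (g (y + τ • P.2) - b) + h / 2 * Q P) (gaussPair E s) := i13.add (i4.const_mul _)
  have i5 : Integrable (fun P : E × E => K * (6 * L ^ 2 + 64 * L ^ 3) * τ ^ 3 * R P ^ 3)
    (gaussPair E s) := hRint.const_mul _
  refine (integral_mono i1 (i14.add i5) hpt).trans ?_
  simp only [Pi.add_apply]
  rw [integral_add i14 i5, integral_add i13 (i4.const_mul _), integral_add i12 i3,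
    integral_add (integrable_const _) i2, e2, e3, integral_const_mul, integral_const_mul]
  have h5 : h / 2 * ∫ P, Q P ∂(gaussPair E s) ≤ 0 :=
    mul_nonpos_of_nonneg_of_nonpos (by linarith [hh.1]) e4
  simp only [integral_const, probReal_univ, one_smul]
  linarith

/-- Over `N` steps of length `1/N` the errors add up to `N · C · N^(-3/2) = C / √N`, which tends to
zero; no regularity of `H` is needed. -/
theorem le_of_forall_add_le_cube {H : ℝ → ℝ} {C : ℝ}
    (hH : ∀ t h, 0 ≤ t → 0 ≤ h → t + h ≤ 1 → H (t + h) ≤ H t + C * √h ^ 3) : H 1 ≤ H 0 := by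
  have hN : ∀ N : ℕ, 0 < N → H 1 ≤ H 0 + C * √(1 / N : ℝ) := by
    intro N hN
    have hN0 : (0 : ℝ) < N := by exact_mod_cast hN
    have hk : ∀ k : ℕ, k ≤ N → H (k / N) ≤ H 0 + k * (C * √(1 / N : ℝ) ^ 3) := by
      intro k
      induction k with
      | zero => intro _; simp
      | succ k ih =>
        intro hk
        have hk' : ((k : ℝ) + 1) / N ≤ 1 := by
          rw [div_le_one hN0]; exact_mod_cast hk
        have := hH (k / N) (1 / N) (by positivity) (by positivity) (by rwa [← add_div])
        rw [← add_div] at this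
        push_cast
        linarith [ih (by omega)]
    have := hk N le_rfl
    rw [div_self hN0.ne'] at this
    have e : (N : ℝ) * (C * √(1 / N : ℝ) ^ 3) = C * √(1 / N : ℝ) := by
      rw [pow_succ, Real.sq_sqrt (by positivity)]
      field_simp
    linarith
  have hlim : Tendsto (fun N : ℕ => H 0 + C * √(1 / N : ℝ)) atTop (𝓝 (H 0 + C * √0)) :=
    ((Real.continuous_sqrt.tendsto 0).comp tendsto_one_div_atTop_nhds_zero_nat).const_mul C
      |>.const_add _
  rw [Real.sqrt_zero, mul_zero, add_zero] at hlim
  exact ge_of_tendsto hlim (eventually_atTop.2 ⟨1, fun N hN' => hN N hN'⟩)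

/-- The functional form of Borell's inequality for regular functions. -/
theorem integral_le_of_hasConcaveExpansion {s ε K L : ℝ} (hs : s ∈ Ioo (0 : ℝ) 1) (hK : 0 ≤ K)
    (hL : 0 ≤ L) {F : ℝ → ℝ → ℝ} (hF : HasConcaveExpansion s ε K F)
    (hFm : Measurable fun p : ℝ × ℝ => F p.1 p.2) (hF01 : ∀ u v, F u v ∈ Icc (0 : ℝ) 1)
    {f g : E → ℝ} (hf : IsRegular L ε f) (hg : IsRegular L ε g) :
    ∫ p, F (f p.1) (g p.2) ∂(gaussPair E s) ≤
      F (∫ x, f x ∂(stdGaussian E)) (∫ x, g x ∂(stdGaussian E)) := by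
  have hs' : s ∈ Icc (-1 : ℝ) 1 := ⟨by linarith [hs.1], hs.2.le⟩
  obtain ⟨C, hC0, hC⟩ := exists_step_bound (E := E) hs hK hL hF hFm hF01
  have hbdd : ∀ {f : E → ℝ}, IsRegular L ε f → ∀ x, |f x| ≤ max |ε| |1 - ε| := fun hf x =>
    abs_le_max_abs_abs (hf.mem_Icc x).1 (hf.mem_Icc x).2
  set H : ℝ → ℝ := fun t => ∫ p, F (gaussAverage (1 - t) f (√t • p.1))
    (gaussAverage (1 - t) g (√t • p.2)) ∂(gaussPair E s) with hH
  have h1 : H 1 = ∫ p, F (f p.1) (g p.2) ∂(gaussPair E s) := by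
    simp [hH, gaussAverage]
  have h0 : H 0 = F (∫ x, f x ∂(stdGaussian E)) (∫ x, g x ∂(stdGaussian E)) := by
    simp [hH, gaussAverage]
  rw [← h1, ← h0]
  refine le_of_forall_add_le_cube (C := C) fun t h ht hh hth => ?_
  set f' := gaussAverage (1 - (t + h)) f with hf'
  set g' := gaussAverage (1 - (t + h)) g with hg'
  have hf'r : IsRegular L ε f' := hf.gaussAverage _
  have hg'r : IsRegular L ε g' := hg.gaussAverage _
  have ef : gaussAverage h f' = gaussAverage (1 - t) f := by
    rw [hf', gaussAverage_gaussAverage hf.measurable (hbdd hf) hh (by linarith)]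
    congr 1; ring
  have eg : gaussAverage h g' = gaussAverage (1 - t) g := by
    rw [hg', gaussAverage_gaussAverage hg.measurable (hbdd hg) hh (by linarith)]
    congr 1; ring
  set G : E × E → ℝ := fun p => F (f' p.1) (g' p.2) with hG
  have hGm : Measurable G := hFm.comp
    ((hf'r.measurable.comp measurable_fst).prodMk (hg'r.measurable.comp measurable_snd))
  -- The pair of variance `t + h` splits into independent correlated pairs of variances `t` and `h`.
  -- Integrating the second one out is a single step based at `√t • p`.
  have hadd := integral_integral_add_of_centered (integral_id_gaussPair hs') hGm (C := 1)
    (fun p => abs_le.2 ⟨by linarith [(hF01 (f' p.1) (g' p.2)).1], (hF01 _ _).2⟩) ht hh 0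
  have hHth : H (t + h) = ∫ p, G (0 + √(t + h) • p) ∂(gaussPair E s) := by
    simp [hH, hG, hf', hg']
  rw [hHth, ← hadd]
  have hpt : ∀ p : E × E, ∫ q, G (0 + √t • p + √h • q) ∂(gaussPair E s) ≤
      F (gaussAverage (1 - t) f (√t • p.1)) (gaussAverage (1 - t) g (√t • p.2)) + C * √h ^ 3 := by
    intro p
    have := hC f' g' hf'r hg'r (√t • p.1) (√t • p.2) h ⟨hh, by linarith⟩
    rw [ef, eg] at this
    simpa [hG] using this
  have i1 : Integrable (fun p : E × E => ∫ q, G (0 + √t • p + √h • q) ∂(gaussPair E s))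
      (gaussPair E s) := by
    have hm : StronglyMeasurable fun z : (E × E) × (E × E) => G (0 + √t • z.1 + √h • z.2) :=
      (hGm.comp (by fun_prop)).stronglyMeasurable
    exact integrable_of_measurable_of_mem_Icc hm.integral_prod_right'.measurable
      fun p => integral_mem_Icc (hGm.comp (by fun_prop)) fun q => hF01 _ _
  have i2 : Integrable (fun p : E × E => F (gaussAverage (1 - t) f (√t • p.1))
      (gaussAverage (1 - t) g (√t • p.2))) (gaussPair E s) := by
    refine integrable_of_measurable_of_mem_Icc (hFm.comp (Measurable.prodMk ?_ ?_))
      fun p => hF01 _ _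
    · exact (hf.gaussAverage _).measurable.comp (by fun_prop)
    · exact (hg.gaussAverage _).measurable.comp (by fun_prop)
  refine (integral_mono i1 (i2.add (integrable_const _)) hpt).trans ?_
  simp only [Pi.add_apply]
  rw [integral_add i2 (integrable_const _)]
  simp [hH]

end Semigroup

/-! ### Borell's inequality for sets, for both signs of the correlation, and equality for
half-spaces. -/

section Borell

open Filter Topology
open scoped Manifold ContDiff

variable {E : Type*} [NormedAddCommGroup E] [InnerProductSpace ℝ E] [FiniteDimensional ℝ E]

theorem exists_gradient_expansion_of_hasCompactSupport {f : E → ℝ} (hf : ContDiff ℝ 2 f)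
    (hc : HasCompactSupport f) :
    ∃ L, 0 ≤ L ∧ ∃ d : E → E, Continuous d ∧ (∀ x, ‖d x‖ ≤ L) ∧
      ∀ x h, |f (x + h) - f x - inner ℝ (d x) h| ≤ L * ‖h‖ ^ 2 := by
  have hd1 : ContDiff ℝ 1 (fderiv ℝ f) := hf.fderiv_right (by norm_num)
  obtain ⟨L₁, hL₁⟩ := (hc.fderiv ℝ).exists_bound_of_continuous hd1.continuous
  obtain ⟨L₂, hL₂⟩ := hd1.lipschitzWith_of_hasCompactSupport (hc.fderiv ℝ) one_ne_zero
  have hdual : ∀ x h, inner ℝ (gradient f x) h = fderiv ℝ f x h := fun x h => by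
    rw [← toDual_gradient, InnerProductSpace.toDual_apply_apply]
  refine ⟨max L₁ L₂, le_max_of_le_right L₂.2, gradient f, ?_, fun x => ?_, fun x h => ?_⟩
  · exact (InnerProductSpace.toDual ℝ E).symm.continuous.comp hd1.continuous
  · rw [gradient, LinearIsometryEquiv.norm_map]
    exact (hL₁ x).trans (le_max_left _ _)
  · have hseg : ∀ z ∈ segment ℝ x (x + h), ‖fderiv ℝ f z - fderiv ℝ f x‖ ≤ L₂ * ‖h‖ := by
      intro z hz
      have h1 := hL₂.dist_le_mul z x
      rw [dist_eq_norm, dist_eq_norm] at h1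
      have h2 : ‖z - x‖ ≤ ‖h‖ := by
        have := norm_sub_le_of_mem_segment hz
        simpa using this
      exact h1.trans (mul_le_mul_of_nonneg_left h2 L₂.2)
    have h3 := (convex_segment x (x + h)).norm_image_sub_le_of_norm_fderiv_le'
      (fun z _ => hf.differentiable (by norm_num) z) hseg (left_mem_segment ℝ x (x + h))
      (right_mem_segment ℝ x (x + h))
    rw [add_sub_cancel_left, ← hdual, Real.norm_eq_abs] at h3
    refine h3.trans ?_
    rw [mul_assoc, ← pow_two]
    exact mul_le_mul_of_nonneg_right (le_max_right _ _) (by positivity)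

variable [MeasurableSpace E] [BorelSpace E]

omit [FiniteDimensional ℝ E] [BorelSpace E] in
theorem IsRegular.mono {L L' ε : ℝ} {f : E → ℝ} (hf : IsRegular L ε f) (h : L ≤ L') :
    IsRegular L' ε f := by
  obtain ⟨d, hd, hdL, hexp⟩ := hf.expansion
  exact ⟨hf.measurable, hf.mem_Icc, d, hd, fun x => (hdL x).trans h, fun x y =>
    (hexp x y).trans (mul_le_mul_of_nonneg_right h (by positivity))⟩

/-- Approximation of the indicator function of a measurable set by regular functions. -/
theorem exists_isRegular_approx {A : Set E} (hA : MeasurableSet A) {δ : ℝ}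
    (hδ : δ ∈ Ioo (0 : ℝ) (1 / 2)) :
    ∃ L, 0 ≤ L ∧ ∃ f : E → ℝ, IsRegular L δ f ∧
      (∫ x, f x ∂(stdGaussian E) ≤ (stdGaussian E).real A + 2 * δ) ∧
      ∃ S, MeasurableSet S ∧ (stdGaussian E).real (A \ S) ≤ δ ∧ ∀ x ∈ S, f x = 1 - δ := by
  have hδ0 : ENNReal.ofReal δ ≠ 0 := by simpa using hδ.1
  obtain ⟨S, hSA, hS, hSδ⟩ := hA.exists_isCompact_sdiff_lt (measure_ne_top (stdGaussian E) A) hδ0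
  obtain ⟨U, hAU, hU, hUδ⟩ := A.exists_isOpen_lt_add (measure_ne_top (stdGaussian E) A) hδ0
  -- Cutting `U` down to a compact set gives the bump function compact support, hence bounded and
  -- Lipschitz derivative.
  obtain ⟨T, hT, hST⟩ := exists_compact_superset hS
  have hUreal : (stdGaussian E).real U ≤ (stdGaussian E).real A + δ := by
    have := ENNReal.toReal_mono (by simp) hUδ.le
    rwa [ENNReal.toReal_add (by simp) (by simp), ENNReal.toReal_ofReal hδ.1.le] at this
  have hsub : S ⊆ interior (U ∩ T) := by
    rw [interior_inter, hU.interior_eq]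
    exact subset_inter (hSA.trans hAU) hST
  obtain ⟨f₀, hf1, hf0, hf01⟩ := exists_contMDiffMap_one_nhds_of_subset_interior
    (n := (2 : ℕ∞)) 𝓘(ℝ, E) hS.isClosed hsub
  have hsmooth : ContDiff ℝ 2 f₀ := f₀.contMDiff.contDiff
  have hcompact : HasCompactSupport f₀ :=
    HasCompactSupport.intro hT fun x hx => hf0 x fun h => hx h.2
  obtain ⟨L, hL, d, hd, hdL, hexp⟩ := exists_gradient_expansion_of_hasCompactSupport hsmooth hcompact
  have hc0 : 0 ≤ 1 - 2 * δ := by linarith [hδ.2]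
  have hc1 : 1 - 2 * δ ≤ 1 := by linarith [hδ.1]
  have hmeas : Measurable f₀ := hsmooth.continuous.measurable
  have hint : Integrable f₀ (stdGaussian E) := integrable_of_measurable_of_mem_Icc hmeas hf01
  -- This affine map carries `[0, 1]` onto `[δ, 1 - δ]` and does not increase the constant `L`.
  refine ⟨L, hL, fun x => δ + (1 - 2 * δ) * f₀ x, ⟨by fun_prop, fun x => ?_,
    fun x => (1 - 2 * δ) • d x, ?_, fun x => ?_, fun x h => ?_⟩, ?_, S, hS.measurableSet, ?_,
    fun x hx => ?_⟩
  · have h1 := mul_nonneg hc0 (hf01 x).1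
    have h2 := mul_le_mul_of_nonneg_left (hf01 x).2 hc0
    constructor <;> linarith
  · exact (hd.const_smul (1 - 2 * δ)).measurable
  · rw [norm_smul, Real.norm_eq_abs, abs_of_nonneg hc0]
    nlinarith [norm_nonneg (d x), hdL x]
  · have e : δ + (1 - 2 * δ) * f₀ (x + h) - (δ + (1 - 2 * δ) * f₀ x) -
        inner ℝ ((1 - 2 * δ) • d x) h =
        (1 - 2 * δ) * (f₀ (x + h) - f₀ x - inner ℝ (d x) h) := by
      rw [real_inner_smul_left]; ring
    rw [e, abs_mul, abs_of_nonneg hc0]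
    nlinarith [abs_nonneg (f₀ (x + h) - f₀ x - inner ℝ (d x) h), hexp x h]
  · have h1 : ∫ x, f₀ x ∂(stdGaussian E) ≤ (stdGaussian E).real U := by
      rw [← integral_indicator_one hU.measurableSet]
      refine integral_mono hint ((integrable_const (1 : ℝ)).indicator hU.measurableSet) fun x => ?_
      by_cases hx : x ∈ U
      · simpa [hx] using (hf01 x).2
      · simp [hx, hf0 x fun h => hx h.1]
    have h2 : 0 ≤ ∫ x, f₀ x ∂(stdGaussian E) := integral_nonneg fun x => (hf01 x).1
    rw [integral_add (integrable_const _) (hint.const_mul _), integral_const_mul]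
    simp only [integral_const, probReal_univ, one_smul]
    nlinarith
  · have := ENNReal.toReal_mono (by simp) hSδ.le
    rwa [ENNReal.toReal_ofReal hδ.1.le] at this
  · simp only
    rw [hf1.self_of_nhdsSet x hx]
    ring

theorem M_one_one (s : ℝ) : M 1 1 s = 1 := by
  simp [M, halfLine_of_one_le le_rfl]

/-- **Borell's inequality** on the noise stability of sets, for positive correlation. -/
theorem gaussPair_real_prod_le {s : ℝ} (hs : s ∈ Ioo (0 : ℝ) 1) {A B : Set E}
    (hA : MeasurableSet A) (hB : MeasurableSet B) :
    (gaussPair E s).real (A ×ˢ B) ≤ M ((stdGaussian E).real A) ((stdGaussian E).real B) s := by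
  have hs' : s ∈ Icc (-1 : ℝ) 1 := ⟨by linarith [hs.1], hs.2.le⟩
  -- The `8δ` is `2δ` for passing to `S ×ˢ T`, `2δ` for `M (1 - δ) (1 - δ) s ≥ 1 - 2δ` on that set,
  -- and `4δ` for the excess of the two integrals over the measures.
  have key : ∀ δ ∈ Ioo (0 : ℝ) (1 / 2), (gaussPair E s).real (A ×ˢ B) ≤
      M ((stdGaussian E).real A) ((stdGaussian E).real B) s + 8 * δ := by
    intro δ hδ
    obtain ⟨K, hK, hF⟩ := exists_hasConcaveExpansion_M hs hδ.1
    obtain ⟨L₁, hL₁, f, hf, hfA, S, hS, hSA, hfS⟩ := exists_isRegular_approx hA hδ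
    obtain ⟨L₂, hL₂, g, hg, hgB, T, hT, hTB, hgT⟩ := exists_isRegular_approx hB hδ
    have hfun := integral_le_of_hasConcaveExpansion hs hK (le_max_of_le_left hL₁) hF
      (measurable_M s) (fun u v => ⟨M_nonneg u v s, M_le_one u v s⟩)
      (hf.mono (le_max_left L₁ L₂)) (hg.mono (le_max_right L₁ L₂))
    have hlow : (1 - 2 * δ) * (gaussPair E s).real (S ×ˢ T) ≤
        ∫ p, M (f p.1) (g p.2) s ∂(gaussPair E s) := by
      have hST := hS.prod hT
      rw [← integral_indicator_one hST, ← integral_const_mul]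
      refine integral_mono (((integrable_const (1 : ℝ)).indicator hST).const_mul _)
        (integrable_of_measurable_of_mem_Icc ((measurable_M s).comp
          ((hf.measurable.comp measurable_fst).prodMk (hg.measurable.comp measurable_snd)))
          fun p => ⟨M_nonneg _ _ s, M_le_one _ _ s⟩) fun p => ?_
      by_cases hp : p ∈ S ×ˢ T
      · have h1 : 0 ≤ 1 - δ := by linarith [hδ.2]
        have h2 : 1 - δ ≤ 1 := by linarith [hδ.1]
        have := M_sub_le hs' h1 h2 h1 h2
        rw [M_one_one] at this
        simp only [indicator_of_mem hp, Pi.one_apply, mul_one, hfS p.1 hp.1, hgT p.2 hp.2]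
        linarith
      · simpa [indicator_of_notMem hp] using M_nonneg _ _ s
    have hup : M (∫ x, f x ∂(stdGaussian E)) (∫ x, g x ∂(stdGaussian E)) s ≤
        M ((stdGaussian E).real A) ((stdGaussian E).real B) s + 4 * δ := by
      have h1 := M_mono s hfA hgB
      have h2 := M_sub_le hs' (measureReal_nonneg (μ := stdGaussian E) (s := A))
        (by linarith [hδ.1] : (stdGaussian E).real A ≤ (stdGaussian E).real A + 2 * δ)
        (measureReal_nonneg (μ := stdGaussian E) (s := B))
        (by linarith [hδ.1] : (stdGaussian E).real B ≤ (stdGaussian E).real B + 2 * δ)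
      linarith
    have hcover : (gaussPair E s).real (A ×ˢ B) ≤ (gaussPair E s).real (S ×ˢ T) + 2 * δ := by
      have hsub : A ×ˢ B ⊆ S ×ˢ T ∪ (Prod.fst ⁻¹' (A \ S) ∪ Prod.snd ⁻¹' (B \ T)) := by
        rintro p ⟨hpA, hpB⟩
        by_cases h1 : p.1 ∈ S
        · by_cases h2 : p.2 ∈ T
          · exact Or.inl ⟨h1, h2⟩
          · exact Or.inr (Or.inr ⟨hpB, h2⟩)
        · exact Or.inr (Or.inl ⟨hpA, h1⟩)
      have m1 : (gaussPair E s).real (Prod.fst ⁻¹' (A \ S)) ≤ δ := by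
        rw [← map_measureReal_apply measurable_fst (hA.diff hS), gaussPair_map_fst]
        exact hSA
      have m2 : (gaussPair E s).real (Prod.snd ⁻¹' (B \ T)) ≤ δ := by
        rw [← map_measureReal_apply measurable_snd (hB.diff hT), gaussPair_map_snd hs']
        exact hTB
      have := (measureReal_mono hsub).trans ((measureReal_union_le (μ := gaussPair E s) _ _).trans
        (add_le_add_right (measureReal_union_le _ _) _))
      linarith
    have h1 : (gaussPair E s).real (S ×ˢ T) ≤ 1 := measureReal_le_one
    nlinarith [hδ.1]
  refine le_of_forall_pos_le_add fun ε hε => ?_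
  have hmin : min (ε / 8) (1 / 4) ∈ Ioo (0 : ℝ) (1 / 2) :=
    ⟨lt_min (by linarith) (by norm_num), (min_le_right _ _).trans_lt (by norm_num)⟩
  refine (key _ hmin).trans ?_
  linarith [min_le_left (ε / 8) (1 / 4)]

/-- Each factor may be changed on a null set of its marginal. Lower sets cover open and closed
half-lines, and also `∅` and `univ`, which arise as sections when `r = ±1`. -/
theorem corrGaussian_real_prod_of_isLowerSet {s : ℝ} (hs : s ∈ Icc (-1 : ℝ) 1) {L₁ L₂ : Set ℝ}
    (h₁ : IsLowerSet L₁) (h₂ : IsLowerSet L₂) :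
    (corrGaussian s).real (L₁ ×ˢ L₂) =
      M ((gaussianReal 0 1).real L₁) ((gaussianReal 0 1).real L₂) s := by
  have e1 : (corrGaussian s).map Prod.fst = gaussianReal 0 1 := by
    rw [corrGaussian_eq_gaussPair, gaussPair_map_fst, stdGaussian_real]
  have e2 : (corrGaussian s).map Prod.snd = gaussianReal 0 1 := by
    rw [corrGaussian_eq_gaussPair, gaussPair_map_snd hs, stdGaussian_real]
  have q1 : MeasurePreserving Prod.fst (corrGaussian s) (gaussianReal 0 1) := ⟨measurable_fst, e1⟩
  have q2 : MeasurePreserving Prod.snd (corrGaussian s) (gaussianReal 0 1) := ⟨measurable_snd, e2⟩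
  rw [M, Set.prod_eq, Set.prod_eq]
  exact measureReal_congr
    ((q1.quasiMeasurePreserving.preimage_ae_eq (ae_eq_halfLine_of_isLowerSet h₁)).inter
      (q2.quasiMeasurePreserving.preimage_ae_eq (ae_eq_halfLine_of_isLowerSet h₂)))

theorem stdGaussian_real_neg (B : Set E) : (stdGaussian E).real (-B) = (stdGaussian E).real B := by
  have h := stdGaussian_map (LinearIsometryEquiv.neg ℝ (E := E))
  conv_rhs => rw [← h]
  rw [measureReal_def, measureReal_def, show ⇑(LinearIsometryEquiv.neg ℝ (E := E)) =
    ⇑(MeasurableEquiv.neg E) from rfl, MeasurableEquiv.map_apply]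
  rfl

/-- Reflecting the second coordinate changes the sign of the correlation; complementing then
subtracts from the marginal, which reverses inequalities. -/
theorem gaussPair_real_prod_eq_sub {s : ℝ} (hs : s ∈ Icc (-1 : ℝ) 1) {A B : Set E}
    (hA : MeasurableSet A) (hB : MeasurableSet B) :
    (gaussPair E s).real (A ×ˢ B) =
      (stdGaussian E).real A - (gaussPair E (-s)).real (A ×ˢ (-B)ᶜ) := by
  have hs' : -s ∈ Icc (-1 : ℝ) 1 := ⟨by linarith [hs.2], by linarith [hs.1]⟩
  have h := gaussPair_map_neg_snd (E := E) hs'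
  rw [neg_neg] at h
  have h1 : (gaussPair E s).real (A ×ˢ B) = (gaussPair E (-s)).real (A ×ˢ (-B)) := by
    rw [← h, map_measureReal_apply (by fun_prop) (hA.prod hB)]
    rfl
  have h2 : (stdGaussian E).real A = (gaussPair E (-s)).real (Prod.fst ⁻¹' A) := by
    rw [← map_measureReal_apply measurable_fst hA, gaussPair_map_fst]
  rw [h1, h2, ← measureReal_inter_add_sdiff (s := Prod.fst ⁻¹' A) (measurable_snd hB.neg)]
  rw [show A ×ˢ (-B)ᶜ = Prod.fst ⁻¹' A \ Prod.snd ⁻¹' (-B) from rfl,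
    show A ×ˢ (-B) = Prod.fst ⁻¹' A ∩ Prod.snd ⁻¹' (-B) from rfl]
  ring

/-- The set identity applied to half-lines: the complement of a reflected lower set is again a lower
set, of measure `1 - v`. -/
theorem M_eq_sub {u v s : ℝ} (hs : s ∈ Icc (-1 : ℝ) 1) (hu : u ∈ Icc (0 : ℝ) 1)
    (hv : v ∈ Icc (0 : ℝ) 1) : M u v s = u - M u (1 - v) (-s) := by
  have hs' : -s ∈ Icc (-1 : ℝ) 1 := ⟨by linarith [hs.2], by linarith [hs.1]⟩
  have hlow : ∀ u, IsLowerSet (halfLine u) := fun u a b hba ha =>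
    (strictMono_Phi.monotone hba).trans_lt ha
  have hlow' : IsLowerSet (-halfLine v)ᶜ := fun a b hba ha hb =>
    ha (hlow v (neg_le_neg hba) hb)
  have h1 : (gaussianReal 0 1).real (-halfLine v)ᶜ = 1 - v := by
    rw [probReal_compl_eq_one_sub (measurableSet_halfLine v).neg, ← stdGaussian_real,
      stdGaussian_real_neg, stdGaussian_real, gaussianReal_halfLine hv]
  have h2 := corrGaussian_real_prod_of_isLowerSet hs' (hlow u) hlow'
  rw [h1, gaussianReal_halfLine hu, corrGaussian_eq_gaussPair] at h2
  rw [← h2, M, corrGaussian_eq_gaussPair, gaussPair_real_prod_eq_sub hs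
    (measurableSet_halfLine u) (measurableSet_halfLine v), stdGaussian_real,
    gaussianReal_halfLine hu]

/-- **Borell's inequality** on the noise stability of sets, for negative correlation. -/
theorem le_gaussPair_real_prod {s : ℝ} (hs : s ∈ Ioo (-1 : ℝ) 0) {A B : Set E}
    (hA : MeasurableSet A) (hB : MeasurableSet B) :
    M ((stdGaussian E).real A) ((stdGaussian E).real B) s ≤ (gaussPair E s).real (A ×ˢ B) := by
  have hs' : s ∈ Icc (-1 : ℝ) 1 := ⟨hs.1.le, by linarith [hs.2]⟩
  have h := gaussPair_real_prod_le (s := -s) ⟨by linarith [hs.2], by linarith [hs.1]⟩ hA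
    hB.neg.compl
  rw [probReal_compl_eq_one_sub hB.neg, stdGaussian_real_neg] at h
  rw [M_eq_sub hs' ⟨measureReal_nonneg, measureReal_le_one⟩
    ⟨measureReal_nonneg, measureReal_le_one⟩, gaussPair_real_prod_eq_sub hs' hA hB]
  linarith

theorem gaussPair_map_inner {s : ℝ} (hs : s ∈ Icc (-1 : ℝ) 1) {e : E} (he : ‖e‖ = 1) :
    (gaussPair E s).map (fun p => (inner ℝ e p.1, inner ℝ e p.2)) = gaussPair ℝ s := by
  set Λ : E × E →L[ℝ] ℝ × ℝ := ((innerSL ℝ e).comp (ContinuousLinearMap.fst ℝ E E)).prod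
    ((innerSL ℝ e).comp (ContinuousLinearMap.snd ℝ E E)) with hΛ
  have hfun : (fun p : E × E => ((inner ℝ e p.1, inner ℝ e p.2) : ℝ × ℝ)) = Λ := rfl
  rw [hfun]
  have : IsProbabilityMeasure ((gaussPair E s).map Λ) :=
    Measure.isProbabilityMeasure_map (by fun_prop)
  apply ext_of_charFunDual_pairDual
  intro a b
  have h : (pairDual a b).comp Λ = pairDual (a • e) (b • e) := by
    ext x <;> simp [hΛ, inner_smul_left, mul_comm]
  rw [charFunDual_map, h, charFunDual_gaussPair hs, charFunDual_gaussPair hs, norm_smul, norm_smul,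
    inner_smul_left, inner_smul_right, real_inner_self_eq_norm_sq, he]
  congr 2
  simp [mul_comm]

/-- Equality in Borell's inequality for parallel half-spaces, given as preimages of lower sets. -/
theorem gaussPair_real_prod_of_isLowerSet {s : ℝ} (hs : s ∈ Icc (-1 : ℝ) 1) {e : E} (he : ‖e‖ = 1)
    {L₁ L₂ : Set ℝ} (h₁ : IsLowerSet L₁) (h₂ : IsLowerSet L₂) :
    (gaussPair E s).real ({x | inner ℝ e x ∈ L₁} ×ˢ {x | inner ℝ e x ∈ L₂}) =
      M ((stdGaussian E).real {x | inner ℝ e x ∈ L₁})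
        ((stdGaussian E).real {x | inner ℝ e x ∈ L₂}) s := by
  have hL₁ : MeasurableSet L₁ := h₁.ordConnected.measurableSet
  have hL₂ : MeasurableSet L₂ := h₂.ordConnected.measurableSet
  have hmap := gaussPair_map_inner hs he
  have hmarg : (stdGaussian E).map (fun x => inner ℝ e x) = gaussianReal 0 1 := by
    rw [← stdGaussian_real, ← gaussPair_map_fst (E := ℝ) s, ← hmap, ← gaussPair_map_fst (E := E) s,
      Measure.map_map (by fun_prop) (by fun_prop), Measure.map_map (by fun_prop) (by fun_prop)]
    rfl
  have hm : ∀ L : Set ℝ, MeasurableSet L →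
      (stdGaussian E).real {x | inner ℝ e x ∈ L} = (gaussianReal 0 1).real L := fun L hL => by
    rw [← hmarg, map_measureReal_apply (by fun_prop) hL]
    rfl
  rw [hm L₁ hL₁, hm L₂ hL₂, ← corrGaussian_real_prod_of_isLowerSet hs h₁ h₂,
    corrGaussian_eq_gaussPair, ← hmap, map_measureReal_apply (by fun_prop) (hL₁.prod hL₂)]
  rfl

end Borell

/-! ### Noise sections, disintegration and the final assembly. -/

section Main

variable {n : ℕ}

theorem measurable_gaussVol_noiseSection (r : ℝ) {A : Set (EuclideanSpace ℝ (Fin n))}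
    (hA : MeasurableSet A) : Measurable fun x => gaussVol (noiseSection r A x) := by
  have h : MeasurableSet {q : EuclideanSpace ℝ (Fin n) × EuclideanSpace ℝ (Fin n) |
      r • q.1 + √(1 - r ^ 2) • q.2 ∈ A} :=
    (by fun_prop : Measurable fun q : EuclideanSpace ℝ (Fin n) × EuclideanSpace ℝ (Fin n) =>
      r • q.1 + √(1 - r ^ 2) • q.2) hA
  exact (measurable_measure_prodMk_left (ν := stdGaussian (EuclideanSpace ℝ (Fin n)))
    h).ennreal_toReal

theorem measurableSet_noiseSection (r : ℝ) {A : Set (EuclideanSpace ℝ (Fin n))}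
    (hA : MeasurableSet A) (x : EuclideanSpace ℝ (Fin n)) : MeasurableSet (noiseSection r A x) :=
  (by fun_prop : Measurable fun y : EuclideanSpace ℝ (Fin n) => r • x + √(1 - r ^ 2) • y) hA

/-- The fixed-point equation survives `r₁ r₂ = 1`: then `(1 - r₁²)(1 - r₂²) = -(r₁ - r₂)² ≤ 0`, so
the noise term vanishes and any `ρ` is a solution. -/
theorem correlation_eq {r₁ r₂ s ρ : ℝ} (hr₁ : r₁ ∈ Icc (-1 : ℝ) 1) (hr₂ : r₂ ∈ Icc (-1 : ℝ) 1)
    (hρ : r₁ * r₂ ≠ 1 → ρ = s * (√((1 - r₁ ^ 2) * (1 - r₂ ^ 2)) / (1 - r₁ * r₂))) :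
    ρ = r₁ * r₂ * ρ + s * (√(1 - r₁ ^ 2) * √(1 - r₂ ^ 2)) := by
  have h1 : 0 ≤ 1 - r₁ ^ 2 := by nlinarith [hr₁.1, hr₁.2]
  have h2 : 0 ≤ 1 - r₂ ^ 2 := by nlinarith [hr₂.1, hr₂.2]
  rw [← Real.sqrt_mul h1]
  by_cases h : r₁ * r₂ = 1
  · have : (1 - r₁ ^ 2) * (1 - r₂ ^ 2) ≤ 0 := by nlinarith [sq_nonneg (r₁ - r₂)]
    rw [h, Real.sqrt_eq_zero_of_nonpos this]
    ring
  · have hne : 1 - r₁ * r₂ ≠ 0 := sub_ne_zero.2 (Ne.symm h)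
    have := hρ h
    rw [← mul_div_assoc, eq_div_iff hne] at this
    linarith

/-- Disintegration of the joint law along the noise. -/
theorem measureReal_prod_eq_integral_noiseSection {r₁ r₂ s ρ : ℝ} (hr₁ : r₁ ∈ Icc (-1 : ℝ) 1)
    (hr₂ : r₂ ∈ Icc (-1 : ℝ) 1) (hs : s ∈ Icc (-1 : ℝ) 1)
    (hρ : ρ = r₁ * r₂ * ρ + s * (√(1 - r₁ ^ 2) * √(1 - r₂ ^ 2)))
    {ν : Measure (EuclideanSpace ℝ (Fin n) × EuclideanSpace ℝ (Fin n))} [IsProbabilityMeasure ν]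
    (hν : ∀ a b, charFunDual ν (pairDual a b) =
      Complex.exp ((-(‖a‖ ^ 2 + 2 * ρ * inner ℝ a b + ‖b‖ ^ 2) / 2 : ℝ)))
    {A B : Set (EuclideanSpace ℝ (Fin n))} (hA : MeasurableSet A) (hB : MeasurableSet B) :
    Integrable (fun p => (gaussPair (EuclideanSpace ℝ (Fin n)) s).real
      (noiseSection r₁ A p.1 ×ˢ noiseSection r₂ B p.2)) ν ∧
    ν.real (A ×ˢ B) = ∫ p, (gaussPair (EuclideanSpace ℝ (Fin n)) s).real
      (noiseSection r₁ A p.1 ×ˢ noiseSection r₂ B p.2) ∂ν := by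
  have hmix := map_mix_eq hr₁ hr₂ hs hν hρ
  have hmeas : Measurable (fun q : (EuclideanSpace ℝ (Fin n) × EuclideanSpace ℝ (Fin n)) ×
      (EuclideanSpace ℝ (Fin n) × EuclideanSpace ℝ (Fin n)) =>
      (r₁ • q.1.1 + √(1 - r₁ ^ 2) • q.2.1, r₂ • q.1.2 + √(1 - r₂ ^ 2) • q.2.2)) := by fun_prop
  have hS := hmeas (hA.prod hB)
  have hsec := measurable_measure_prodMk_left (ν := gaussPair (EuclideanSpace ℝ (Fin n)) s) hS
  constructor
  · exact integrable_of_measurable_of_mem_Icc hsec.ennreal_toReal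
      fun p => ⟨measureReal_nonneg, measureReal_le_one⟩
  -- Only the left-hand `ν` is replaced by the image of the product. Fubini then yields fibres that
  -- are products of noise sections by definition.
  · conv_lhs => rw [← hmix]
    rw [map_measureReal_apply hmeas (hA.prod hB), measureReal_def, Measure.prod_apply hS,
      ← integral_toReal hsec.aemeasurable (Filter.Eventually.of_forall fun x => measure_lt_top _ _)]
    rfl

theorem IsHalfspace.exists_isLowerSet {θ : EuclideanSpace ℝ (Fin n)}
    {A : Set (EuclideanSpace ℝ (Fin n))} (h : IsHalfspace θ A) :
    ∃ L : Set ℝ, IsLowerSet L ∧ A = {x | inner ℝ θ x ∈ L} := by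
  obtain ⟨a, rfl | rfl⟩ := h
  · exact ⟨Iio a, isLowerSet_Iio a, rfl⟩
  · exact ⟨Iic a, isLowerSet_Iic a, rfl⟩

/-- The section only translates by a multiple of `r` and dilates by `√(1 - r²) c ≥ 0`, so the
direction `e` is kept whatever the sign of `r`. -/
theorem exists_noiseSection_eq_of_isLowerSet {θ e : EuclideanSpace ℝ (Fin n)} {c : ℝ} (hc : 0 ≤ c)
    (hθ : θ = c • e) {L : Set ℝ} (hL : IsLowerSet L) (r : ℝ) (x : EuclideanSpace ℝ (Fin n)) :
    ∃ L' : Set ℝ, IsLowerSet L' ∧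
      noiseSection r {x | inner ℝ θ x ∈ L} x = {y | inner ℝ e y ∈ L'} := by
  refine ⟨{t | r * inner ℝ θ x + √(1 - r ^ 2) * (c * t) ∈ L}, fun a b hba ha => hL ?_ ha, ?_⟩
  · gcongr
  · ext y
    simp only [noiseSection, mem_ofPred_eq, inner_add_right, inner_smul_right]
    rw [hθ, real_inner_smul_left _ y]

end Main

end NoisyBorell

theorem mainTheorem10 {Ω : Type*} [MeasurableSpace Ω] (P : Measure Ω) [IsProbabilityMeasure P]
    (n : ℕ) (r₁ r₂ s ρ : ℝ)
    (hr₁ : r₁ ∈ Icc (-1 : ℝ) 1) (hr₂ : r₂ ∈ Icc (-1 : ℝ) 1) (hs : s ∈ Icc (-1 : ℝ) 1)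
    (hρ : r₁ * r₂ ≠ 1 → ρ = s * (√((1 - r₁ ^ 2) * (1 - r₂ ^ 2)) / (1 - r₁ * r₂)))
    (X Y : Ω → EuclideanSpace ℝ (Fin n))
    (hXY : NoisyBorell.IsCorrelatedStdGaussian ρ X Y P) :
    (∀ A B : Set (EuclideanSpace ℝ (Fin n)), MeasurableSet A → MeasurableSet B →
      Integrable (NoisyBorell.noisyM r₁ r₂ s A B X Y) P ∧
      (s ∈ Ioo (0 : ℝ) 1 →
        P.real {ω | X ω ∈ A ∧ Y ω ∈ B} ≤ ∫ ω, NoisyBorell.noisyM r₁ r₂ s A B X Y ω ∂P) ∧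
      (s ∈ Ioo (-1 : ℝ) 0 →
        ∫ ω, NoisyBorell.noisyM r₁ r₂ s A B X Y ω ∂P ≤ P.real {ω | X ω ∈ A ∧ Y ω ∈ B})) ∧
    (∀ A B : Set (EuclideanSpace ℝ (Fin n)), NoisyBorell.AreParallelHalfspaces A B →
      P.real {ω | X ω ∈ A ∧ Y ω ∈ B} = ∫ ω, NoisyBorell.noisyM r₁ r₂ s A B X Y ω ∂P) := by
  open NoisyBorell in
  have hXYm : AEMeasurable (fun ω => (X ω, Y ω)) P := hXY.hasGaussianLaw.aemeasurable
  set ν := P.map (fun ω => (X ω, Y ω)) with hν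
  have hνprob : IsProbabilityMeasure ν := Measure.isProbabilityMeasure_map hXYm
  have hmean := correlation_eq hr₁ hr₂ hρ
  have hmeasM : ∀ A B : Set (EuclideanSpace ℝ (Fin n)), MeasurableSet A → MeasurableSet B →
      Measurable fun p : EuclideanSpace ℝ (Fin n) × EuclideanSpace ℝ (Fin n) =>
        M (gaussVol (noiseSection r₁ A p.1)) (gaussVol (noiseSection r₂ B p.2)) s :=
    fun A B hA hB => (measurable_M s).comp
      (((measurable_gaussVol_noiseSection r₁ hA).comp measurable_fst).prodMk
        ((measurable_gaussVol_noiseSection r₂ hB).comp measurable_snd))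
  have hintM : ∀ A B : Set (EuclideanSpace ℝ (Fin n)), MeasurableSet A → MeasurableSet B →
      Integrable (fun p : EuclideanSpace ℝ (Fin n) × EuclideanSpace ℝ (Fin n) =>
        M (gaussVol (noiseSection r₁ A p.1)) (gaussVol (noiseSection r₂ B p.2)) s) ν :=
    fun A B hA hB => integrable_of_measurable_of_mem_Icc (hmeasM A B hA hB)
      fun p => ⟨M_nonneg _ _ s, M_le_one _ _ s⟩
  have hleft : ∀ A B : Set (EuclideanSpace ℝ (Fin n)), MeasurableSet A → MeasurableSet B →
      P.real {ω | X ω ∈ A ∧ Y ω ∈ B} = ν.real (A ×ˢ B) := fun A B hA hB => by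
    rw [hν, measureReal_def, measureReal_def, Measure.map_apply_of_aemeasurable hXYm (hA.prod hB)]
    rfl
  have hright : ∀ A B : Set (EuclideanSpace ℝ (Fin n)), MeasurableSet A → MeasurableSet B →
      ∫ ω, noisyM r₁ r₂ s A B X Y ω ∂P =
        ∫ p, M (gaussVol (noiseSection r₁ A p.1)) (gaussVol (noiseSection r₂ B p.2)) s ∂ν :=
    fun A B hA hB => by
      rw [hν, integral_map hXYm (hmeasM A B hA hB).aestronglyMeasurable]
      rfl
  have hdis : ∀ A B : Set (EuclideanSpace ℝ (Fin n)), MeasurableSet A → MeasurableSet B → _ :=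
    fun A B hA hB => measureReal_prod_eq_integral_noiseSection hr₁ hr₂ hs hmean
      hXY.charFunDual_map hA hB
  refine ⟨fun A B hA hB => ⟨?_, fun hs0 => ?_, fun hs0 => ?_⟩, fun A B hAB => ?_⟩
  · exact (hintM A B hA hB).comp_aemeasurable hXYm
  · rw [hleft A B hA hB, hright A B hA hB, (hdis A B hA hB).2]
    exact integral_mono (hdis A B hA hB).1 (hintM A B hA hB) fun p => gaussPair_real_prod_le hs0
      (measurableSet_noiseSection r₁ hA _) (measurableSet_noiseSection r₂ hB _)
  · rw [hleft A B hA hB, hright A B hA hB, (hdis A B hA hB).2]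
    exact integral_mono (hintM A B hA hB) (hdis A B hA hB).1 fun p => le_gaussPair_real_prod hs0
      (measurableSet_noiseSection r₁ hA _) (measurableSet_noiseSection r₂ hB _)
  · obtain ⟨θ, hθ, hAθ, hBθ⟩ := hAB
    obtain ⟨L₁, hL₁, rfl⟩ := hAθ.exists_isLowerSet
    obtain ⟨L₂, hL₂, rfl⟩ := hBθ.exists_isLowerSet
    have hm : ∀ L : Set ℝ, IsLowerSet L →
        MeasurableSet {x : EuclideanSpace ℝ (Fin n) | inner ℝ θ x ∈ L} := fun L hL =>
      (by fun_prop : Measurable fun x : EuclideanSpace ℝ (Fin n) => inner ℝ θ x)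
        hL.ordConnected.measurableSet
    rw [hleft _ _ (hm _ hL₁) (hm _ hL₂), hright _ _ (hm _ hL₁) (hm _ hL₂),
      (hdis _ _ (hm _ hL₁) (hm _ hL₂)).2]
    -- Equality holds for every `p`: both sections are governed by the same unit normal.
    congr with p
    have hθ0 : ‖θ‖ ≠ 0 := norm_ne_zero_iff.2 hθ
    have he : ‖‖θ‖⁻¹ • θ‖ = 1 := by rw [norm_smul, norm_inv, norm_norm, inv_mul_cancel₀ hθ0]
    have hθe : θ = ‖θ‖ • ‖θ‖⁻¹ • θ := (smul_inv_smul₀ hθ0 θ).symm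
    obtain ⟨L₁', hL₁', e₁⟩ := exists_noiseSection_eq_of_isLowerSet (norm_nonneg θ) hθe hL₁ r₁ p.1
    obtain ⟨L₂', hL₂', e₂⟩ := exists_noiseSection_eq_of_isLowerSet (norm_nonneg θ) hθe hL₂ r₂ p.2
    rw [e₁, e₂]
    exact gaussPair_real_prod_of_isLowerSet hs he hL₁' hL₂'
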